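/- **Model.** Let $n\ge 1$, $\lambda\in(0,1)$. There are $n$ parallel servers with infinite FIFO queues; server $i$ works at rate $\mu_i$, where $\mu=(\mu_1,\dots,\mu_n)\in\Sigma_n=\{\mu\in(0,\infty)^n:\sum_i\mu_i=n\}$. Jobs arrive as a renewal process of rate $\lambda n$ (i.i.d. interarrival times with law $G_n$ of mean $1/(\lambda n)$) at times $T_1\le T_2\le\dots$; their sizes $W_1,W_2,\dots\ge 0$ are i.i.d. with law $F$ (not depending on $n$) of mean $1$. A dispatcher has a memory with states $\mathcal M=\{1,\dots,2^{c}\}$ ($c$ bits). $\mathcal Q$ is the set of finite sequences of nonnegative reals, the remaining workloads of the jobs of a queue in order of arrival. A *memory-based dispatching policy* consists of a rate $\beta\ge 0$ and measurable functions $f_1,f_2,f_3,g_1,g_2,g_3,h_1,h_2$ used as follows, where $M(t)$ is the memory state, $Q_i(t)\in\mathcal Q$ the state of queue $i$, $t^-$ denotes the state just before the event, and $U_{j,k}$ ($1\le j\le 8$, $k\ge1$) are independent uniform variables on $[0,1]$; arrivals, sizes, the Poisson process below and the $U_{j,k}$ are independent. * *Arrival of job $k$* (at $t=T_k$): the set $S_k=f_1(M(t^-),W_k,U_{1,k})$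 of servers is queried ($2|S_k|$ messages); with $B=\{(Q_i(t^-),\mu_i,i):i\in S_k\}$ the job joins queue $D_k=f_2(M(t^-),W_k,B,U_{2,k})$, and $M(t)=f_3(M(t^-),W_k,B,D_k,U_{3,k})$. * *$k$-th event of a Poisson process of rate $\beta$* (at time $t$): if $g_1(Q(t),\mu,U_{4,k})=0$ nothing happens. If it equals a server $i$, then server $i$ sends a message, the servers in $S^s_k=g_2(M(t^-),i,Q_i(t),\mu_i,U_{5,k})$ are queried ($1+2|S^s_k|$ messages), and $M(t)=g_3(M(t^-),i,Q_i(t),\mu_i,\{(Q_j(t),\mu_j,j):j\in S^s_k\},U_{6,k})$. * *$k$-th service completion in the system* (at server $i$, time $t$; $Q_i(t)$ is the queue after the departure): if $h_1(Q_i(t),\mu_i,U_{7,k})=1$, server $i$ sends one message and $M(t)=h_2(M(t^-),i,Q_i(t),\mu_i,U_{8,k})$; otherwise no message is sent and $M$ is unchanged. Of simultaneous events, arrivals come first, and service completions are taken in the order of the servers. Let $Z(t)$ be the time elapsed since the last arrival. The process $(Q(t),M(t),Z(t))_{t\ge0}$ is started from a state $(q,m,z)$ with no finished job at the head of a queue and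 $G_n((z,\infty))>0$ (the first interarrival time, begun at time $-z$, is conditioned to exceed $z$); the initial state may be random, independent of everything else apart from this conditioning. The *average message rate* is $\limsup_{t\to\infty}\frac1t\cdot$(number of messages exchanged in $[0,t]$). The *stability region* of the policy is the set of $\mu\in\Sigma_n$ for which $(Q,M,Z)$ is positive Harris recurrent: there is a nonzero $\sigma$-finite measure $\varphi$ on the state space such that every measurable $A$ with $\varphi(A)>0$ is occupied for an infinite total time, almost surely from every initial state, and there is an invariant probability measure. The policy is *weakly symmetric* if for every permutation $\sigma$ of the servers there is a permutation $\sigma_M$ of $\mathcal M$ such that, for $U$ uniform on $[0,1]$ and all $m\in\mathcal M$, $w\ge0$, $S\subset\{1,\dots,n\}$, $q\in\mathcal Q^n$, $\mu\in[0,\infty)^n$, $$\sigma\big(f_1(m,w,U)\big)\overset d= f_1(\sigma_M(m),w,U),$$ $$\sigma\big(f_2(m,w,\{(q_i,\mu_i,i):i\in S\},U)\big)\overset d= f_2\big(\sigma_M(m),w,\{(q_i,\mu_i,\sigma(i)):i\in S\},U\big).$$ **Theorem.** Fix $\lambda\in(0,1)$. Below, an *admissible sequence* consists of a positive sequence $(\alpha_n)_{n\ge1}$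 with $\alpha_n=o(n^2)$, laws $F$ and $(G_n)$ as above, weakly symmetric policies for $n=1,2,\dots$ servers with $c_n=o(\log n)$ bits of memory, and, for each $n$ and $\mu\in\Sigma_n$, a law of the initial state under which the average message rate is almost surely at most $\alpha_n$. 1. There are sets $\Gamma_n(\lambda,r)\subsetneq\Sigma_n$ ($n\ge1$, $r>0$), depending only on $n$, $\lambda$ and $r$, such that for every admissible sequence the stability region of the $n$-th policy is contained in $\Gamma_n(\lambda,\alpha_n)$ for all large $n$. 2. For every job size law $F$ there are constants $a,K>0$ depending only on $\lambda$ and $F$ such that, with $b_n=a\,e^{-K\alpha_n/n}$, the following holds for every admissible sequence with job size law $F$ and all large $n$. If $\mu\in\Sigma_n$ and $\lfloor n/2\rfloor$ servers have the same rate $\mu_i=\varepsilon$, then the total remaining workload $\mathcal W(t)$ satisfies $$\liminf_{t\to\infty}\frac{\mathcal W(t)}{t}\ \ge\ (b_n-\varepsilon)\,n\qquad\text{almost surely};$$ and if $\varepsilon<b_n$, then $\mu$ is not in the stability region, i.e. the process is not positive Harris recurrent. -/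

import Mathlib

open MeasureTheory ProbabilityTheory Filter Asymptotics
open scoped NNReal ENNReal

namespace Dispatch

/-- State of one FIFO queue: the remaining workloads of its jobs, in order of arrival, the job in
service first. An idle server has the empty list. -/
abbrev Queue : Type := List ℝ≥0

/-- The coproduct σ-algebra on the disjoint union of the spaces `ℝ₊ᵏ`, generated by the number of
jobs and by the sequence of remaining workloads (continued by zeros). -/
instance instMeasurableSpaceQueue : MeasurableSpace (List ℝ≥0) :=
  MeasurableSpace.comap (fun l : List ℝ≥0 => (l.length, fun j : ℕ => l.getD j 0)) inferInstance

/-- The coproduct σ-algebra on `Option β`. -/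
instance instMeasurableSpaceOption {β : Type*} [m : MeasurableSpace β] :
    MeasurableSpace (Option β) :=
  MeasurableSpace.map some m

/-- What the dispatcher learns from the queried servers: a set of triples (queue state, service
rate, server) with distinct servers, that is, a partial function on the servers. -/
abbrev Report (n : ℕ) : Type := Fin n → Option (Queue × ℝ≥0)

/-- The set `{(q i, μ i, i) : i ∈ S}`. -/
def report {n : ℕ} (q : Fin n → Queue) (μ : Fin n → ℝ≥0) (S : Finset (Fin n)) : Report n :=
  fun i => if i ∈ S then some (q i, μ i) else none

/-- Replace every triple `(q, μ, i)` by `(q, μ, σ i)`. -/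
def Report.relabel {n : ℕ} (σ : Equiv.Perm (Fin n)) (r : Report n) : Report n :=
  fun i => r (σ.symm i)

/-- A memory-based dispatching policy for `n` servers with `c` bits of memory. -/
structure Policy (n c : ℕ) where
  /-- Rate of the Poisson process of potential spontaneous messages. -/
  β : ℝ≥0
  /-- Servers queried at an arrival: memory, job size, randomization. -/
  f₁ : Fin (2 ^ c) → ℝ≥0 → unitInterval → Finset (Fin n)
  /-- Destination of the job: memory, job size, answers, randomization. -/
  f₂ : Fin (2 ^ c) → ℝ≥0 → Report n → unitInterval → Fin n
  /-- Memory update at an arrival: memory, job size, answers, destination, randomization. -/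
  f₃ : Fin (2 ^ c) → ℝ≥0 → Report n → Fin n → unitInterval → Fin (2 ^ c)
  /-- Sender of a spontaneous message (`none` if nobody sends one). -/
  g₁ : (Fin n → Queue) → (Fin n → ℝ≥0) → unitInterval → Option (Fin n)
  /-- Servers queried at a spontaneous message: memory, sender, its queue and rate. -/
  g₂ : Fin (2 ^ c) → Fin n → Queue → ℝ≥0 → unitInterval → Finset (Fin n)
  /-- Memory update at a spontaneous message. -/
  g₃ : Fin (2 ^ c) → Fin n → Queue → ℝ≥0 → Report n → unitInterval → Fin (2 ^ c)
  /-- Whether a server sends a message at a service completion. -/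
  h₁ : Queue → ℝ≥0 → unitInterval → Bool
  /-- Memory update at a message sent at a service completion. -/
  h₂ : Fin (2 ^ c) → Fin n → Queue → ℝ≥0 → unitInterval → Fin (2 ^ c)
  measurable_f₁ : Measurable fun x : Fin (2 ^ c) × ℝ≥0 × unitInterval => f₁ x.1 x.2.1 x.2.2
  measurable_f₂ : Measurable fun x : Fin (2 ^ c) × ℝ≥0 × Report n × unitInterval =>
    f₂ x.1 x.2.1 x.2.2.1 x.2.2.2
  measurable_f₃ : Measurable fun x : Fin (2 ^ c) × ℝ≥0 × Report n × Fin n × unitInterval =>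
    f₃ x.1 x.2.1 x.2.2.1 x.2.2.2.1 x.2.2.2.2
  measurable_g₁ : Measurable fun x : (Fin n → Queue) × (Fin n → ℝ≥0) × unitInterval =>
    g₁ x.1 x.2.1 x.2.2
  measurable_g₂ : Measurable fun x : Fin (2 ^ c) × Fin n × Queue × ℝ≥0 × unitInterval =>
    g₂ x.1 x.2.1 x.2.2.1 x.2.2.2.1 x.2.2.2.2
  measurable_g₃ : Measurable fun x : Fin (2 ^ c) × Fin n × Queue × ℝ≥0 × Report n × unitInterval =>
    g₃ x.1 x.2.1 x.2.2.1 x.2.2.2.1 x.2.2.2.2.1 x.2.2.2.2.2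
  measurable_h₁ : Measurable fun x : Queue × ℝ≥0 × unitInterval => h₁ x.1 x.2.1 x.2.2
  measurable_h₂ : Measurable fun x : Fin (2 ^ c) × Fin n × Queue × ℝ≥0 × unitInterval =>
    h₂ x.1 x.2.1 x.2.2.1 x.2.2.2.1 x.2.2.2.2

/-- Weak symmetry. Equality in distribution of the finitely-valued `f₁`, `f₂` is equality of all
point probabilities with respect to a uniform variable on `[0, 1]`. -/
def Policy.WeaklySymmetric {n c : ℕ} (P : Policy n c) : Prop :=
  ∀ σ : Equiv.Perm (Fin n), ∃ σM : Equiv.Perm (Fin (2 ^ c)),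
    (∀ (m : Fin (2 ^ c)) (w : ℝ≥0) (S : Finset (Fin n)),
      volume {u : unitInterval | (P.f₁ m w u).map σ.toEmbedding = S} =
        volume {u : unitInterval | P.f₁ (σM m) w u = S}) ∧
    (∀ (m : Fin (2 ^ c)) (w : ℝ≥0) (S : Finset (Fin n)) (q : Fin n → Queue) (μ : Fin n → ℝ≥0)
      (i : Fin n),
      volume {v : unitInterval | σ (P.f₂ m w (report q μ S) v) = i} =
        volume {v : unitInterval | P.f₂ (σM m) w ((report q μ S).relabel σ) v = i})

/-- Positive service rates with total `n`. -/
def rateSet (n : ℕ) : Set (Fin n → ℝ≥0) :=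
  {μ | (∀ i, 0 < μ i) ∧ ∑ i, μ i = n}

/-! ### Fundamental processes -/

/-- Sample space: interarrival times, normalized gaps between spontaneous message events, job
sizes, and eight sequences of randomization variables. -/
abbrev Sample : Type := (ℕ → ℝ≥0) × (ℕ → ℝ≥0) × (ℕ → ℝ≥0) × (Fin 8 → ℕ → unitInterval)

/-- The exponential law with mean one. -/
noncomputable def unitExp : Measure ℝ≥0 := (expMeasure 1).map Real.toNNReal

/-- All coordinates independent: interarrival times of law `G`, unit exponential gaps, job sizes of
law `F`, uniform randomization variables. -/
noncomputable def baseLaw (G F : Measure ℝ≥0) : Measure Sample :=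
  (Measure.infinitePi fun _ : ℕ => G).prod
    ((Measure.infinitePi fun _ : ℕ => unitExp).prod
      ((Measure.infinitePi fun _ : ℕ => F).prod
        (Measure.pi fun _ : Fin 8 => Measure.infinitePi fun _ : ℕ => (volume : Measure unitInterval))))

/-- The law of the fundamental processes when the time elapsed since the previous arrival is `z` at
time zero: the current interarrival time is conditioned to exceed `z`. -/
noncomputable def lawFrom (G F : Measure ℝ≥0) (z : ℝ≥0) : Measure Sample :=
  (baseLaw G F)[|{ω : Sample | z < ω.1 0}]

/-- Time of arrival number `k` (from `0`), when the previous arrival was at time `-z`. -/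
noncomputable def arrivalTime (z : ℝ≥0) (ω : Sample) (k : ℕ) : ℝ≥0 :=
  (∑ j ∈ Finset.range (k + 1), ω.1 j) - z

/-- Time of event number `k` (from `0`) of the Poisson process of rate `β` (`∞` if `β = 0`). -/
noncomputable def messageTime (β : ℝ≥0) (ω : Sample) (k : ℕ) : ℝ≥0∞ :=
  ((∑ j ∈ Finset.range (k + 1), ω.2.1 j : ℝ≥0) : ℝ≥0∞) / (β : ℝ≥0∞)

def jobSize (ω : Sample) (k : ℕ) : ℝ≥0 := ω.2.2.1 k

/-- The randomization variable written `U_{j+1,k+1}` when numbering starts from one. -/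
def unif (ω : Sample) (j : Fin 8) (k : ℕ) : unitInterval := ω.2.2.2 j k

/-! ### Sample paths -/

/-- Values of the process: queues, memory, time elapsed since the previous arrival. -/
abbrev State (n c : ℕ) : Type := (Fin n → Queue) × Fin (2 ^ c) × ℝ≥0

/-- Apply the amount `x` of service to the first job. -/
noncomputable def serve (x : ℝ≥0) : Queue → Queue
  | [] => []
  | w :: l => (w - x) :: l

/-- Evolution during a time `d` without events. -/
noncomputable def flow {n c : ℕ} (μ : Fin n → ℝ≥0) (d : ℝ≥0) (s : State n c) : State n c :=
  (fun i => serve (μ i * d) (s.1 i), s.2.1, s.2.2 + d)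

/-- Time until the next service completion at a server of rate `r` (`∞` if idle). -/
noncomputable def completionDelay (r : ℝ≥0) : Queue → ℝ≥0∞
  | [] => ⊤
  | w :: _ => (w : ℝ≥0∞) / (r : ℝ≥0∞)

/-- Situation just after an event: its time, the state, the numbers of past arrivals, of past events
of the spontaneous message process and of past departures, and the number of messages exchanged. -/
structure Config (n c : ℕ) where
  time : ℝ≥0
  state : State n c
  arr : ℕ
  spon : ℕ
  dep : ℕ
  msgs : ℕ

/-- Arrival of a job at time `t`. -/
noncomputable def onArrival {n c : ℕ} (P : Policy n c) (μ : Fin n → ℝ≥0) (ω : Sample) (t : ℝ≥0)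
    (C : Config n c) : Config n c :=
  let s := flow μ (t - C.time) C.state
  let q := s.1
  let m := s.2.1
  let w := jobSize ω C.arr
  let S := P.f₁ m w (unif ω 0 C.arr)
  let D := P.f₂ m w (report q μ S) (unif ω 1 C.arr)
  { time := t
    state := (Function.update q D (q D ++ [w]),
      P.f₃ m w (report q μ S) D (unif ω 2 C.arr), 0)
    arr := C.arr + 1
    spon := C.spon
    dep := C.dep
    msgs := C.msgs + 2 * S.card }

/-- Event of the spontaneous message process at time `t`. -/
noncomputable def onMessage {n c : ℕ} (P : Policy n c) (μ : Fin n → ℝ≥0) (ω : Sample) (t : ℝ≥0)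
    (C : Config n c) : Config n c :=
  let s := flow μ (t - C.time) C.state
  let q := s.1
  let m := s.2.1
  match P.g₁ q μ (unif ω 3 C.spon) with
  | none => { C with time := t, state := s, spon := C.spon + 1 }
  | some i =>
    let S := P.g₂ m i (q i) (μ i) (unif ω 4 C.spon)
    { time := t
      state := (q, P.g₃ m i (q i) (μ i) (report q μ S) (unif ω 5 C.spon), s.2.2)
      arr := C.arr
      spon := C.spon + 1
      dep := C.dep
      msgs := C.msgs + (1 + 2 * S.card) }

/-- Service completion at server `i` at time `t`. Departures are numbered jointly over all servers,
so that each of them uses fresh randomization variables. -/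
noncomputable def onDeparture {n c : ℕ} (P : Policy n c) (μ : Fin n → ℝ≥0) (ω : Sample) (i : Fin n)
    (t : ℝ≥0) (C : Config n c) : Config n c :=
  let s := flow μ (t - C.time) C.state
  let q := Function.update s.1 i (s.1 i).tail
  let m := s.2.1
  let b := P.h₁ (q i) (μ i) (unif ω 6 C.dep)
  { time := t
    state := (q, if b then P.h₂ m i (q i) (μ i) (unif ω 7 C.dep) else m, s.2.2)
    arr := C.arr
    spon := C.spon
    dep := C.dep + 1
    msgs := C.msgs + if b then 1 else 0 }

open Classical in
/-- The next event. If several are due at the same time, an arrival (which acts on the left limits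
of the processes) comes first, and departures are taken in the order of the servers. -/
noncomputable def step {n c : ℕ} (P : Policy n c) (μ : Fin n → ℝ≥0) (z : ℝ≥0) (ω : Sample)
    (C : Config n c) : Config n c :=
  let ta : ℝ≥0 := arrivalTime z ω C.arr
  let ts : ℝ≥0∞ := messageTime P.β ω C.spon
  let td : Fin n → ℝ≥0∞ := fun i => C.time + completionDelay (μ i) (C.state.1 i)
  if (ta : ℝ≥0∞) ≤ ts ∧ ∀ i, (ta : ℝ≥0∞) ≤ td i then onArrival P μ ω ta C
  else if ∀ i, ts ≤ td i then onMessage P μ ω ts.toNNReal C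
  else
    match (List.finRange n).find? (fun i => decide (∀ j, td i ≤ td j)) with
    | none => C
    | some i => onDeparture P μ ω i (td i).toNNReal C

/-- Situation after the first `k` events, from the initial state `x`. -/
noncomputable def configAfter {n c : ℕ} (P : Policy n c) (μ : Fin n → ℝ≥0) (x : State n c)
    (ω : Sample) (k : ℕ) : Config n c :=
  (step P μ x.2.2 ω)^[k] ⟨0, x, 0, 0, 0, 0⟩

/-- Number of events in `[0, t]`. -/
noncomputable def eventCount {n c : ℕ} (P : Policy n c) (μ : Fin n → ℝ≥0) (x : State n c)
    (t : ℝ≥0) (ω : Sample) : ℕ :=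
  sSup {k : ℕ | (configAfter P μ x ω k).time ≤ t}

/-- Situation just after the last event in `[0, t]`. -/
noncomputable def configAt {n c : ℕ} (P : Policy n c) (μ : Fin n → ℝ≥0) (x : State n c)
    (t : ℝ≥0) (ω : Sample) : Config n c :=
  configAfter P μ x ω (eventCount P μ x t ω)

/-- The process `(Q(t), M(t), Z(t))` started from `x`. -/
noncomputable def process {n c : ℕ} (P : Policy n c) (μ : Fin n → ℝ≥0) (x : State n c)
    (t : ℝ≥0) (ω : Sample) : State n c :=
  flow μ (t - (configAt P μ x t ω).time) (configAt P μ x t ω).state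

/-- Total remaining workload at time `t`. -/
noncomputable def totalWorkload {n c : ℕ} (P : Policy n c) (μ : Fin n → ℝ≥0) (x : State n c)
    (t : ℝ≥0) (ω : Sample) : ℝ≥0 :=
  ∑ i, ((process P μ x t ω).1 i).sum

/-- Average message rate between the dispatcher and the servers. -/
noncomputable def messageRate {n c : ℕ} (P : Policy n c) (μ : Fin n → ℝ≥0) (x : State n c)
    (ω : Sample) : ℝ≥0∞ :=
  limsup (fun t : ℝ≥0 => ((configAt P μ x t ω).msgs : ℝ≥0∞) / (t : ℝ≥0∞)) atTop

/-- Lower growth rate of the total workload. -/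
noncomputable def workloadGrowth {n c : ℕ} (P : Policy n c) (μ : Fin n → ℝ≥0) (x : State n c)
    (ω : Sample) : ℝ≥0∞ :=
  liminf (fun t : ℝ≥0 => (totalWorkload P μ x t ω : ℝ≥0∞) / (t : ℝ≥0∞)) atTop

/-! ### Stability -/

/-- State space of the process for interarrival law `G`: no finished job at the head of a queue, and
an elapsed time that the interarrival time exceeds with positive probability. -/
def stateSpace (n c : ℕ) (G : Measure ℝ≥0) : Set (State n c) :=
  {x | (∀ i, (x.1 i).head? ≠ some 0) ∧ 0 < G (Set.Ioi x.2.2)}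

/-- Positive Harris recurrence of the process `X x` with law `Pr x`, `x ∈ E`: sets of positive
`φ`-measure are visited for an infinite time, almost surely and from every state, and there is an
invariant probability measure. -/
def PositiveHarrisRecurrent {Ω E₀ : Type*} [MeasurableSpace Ω] [MeasurableSpace E₀] (E : Set E₀)
    (Pr : E₀ → Measure Ω) (X : E₀ → ℝ≥0 → Ω → E₀) : Prop :=
  (∃ φ : Measure E₀, SigmaFinite φ ∧ φ ≠ 0 ∧ φ Eᶜ = 0 ∧
    ∀ A : Set E₀, MeasurableSet A → 0 < φ A →
      ∀ x ∈ E, ∀ᵐ ω ∂(Pr x), volume {t : ℝ | 0 ≤ t ∧ X x t.toNNReal ω ∈ A} = ⊤) ∧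
  (∃ π : Measure E₀, IsProbabilityMeasure π ∧ π Eᶜ = 0 ∧
    ∀ (t : ℝ≥0) (A : Set E₀), MeasurableSet A →
      ∫⁻ x, Pr x {ω | X x t ω ∈ A} ∂π = π A)

/-- Service rate vectors for which the process is positive Harris recurrent, for interarrival law
`G` and job size law `F`. -/
def stabilityRegion {n c : ℕ} (P : Policy n c) (G F : Measure ℝ≥0) : Set (Fin n → ℝ≥0) :=
  {μ | μ ∈ rateSet n ∧
    PositiveHarrisRecurrent (stateSpace n c G) (fun x => lawFrom G F x.2.2) (process P μ)}

/-- A sequence of weakly symmetric policies `P n` with `c n = o(log n)` bits of memory, for renewal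
arrivals of rate `lam * n` and i.i.d. job sizes of mean one, whose average message rate, from initial
states of law `ν n μ`, is almost surely at most `α n = o(n ^ 2)`. -/
structure Admissible (lam : ℝ) (α : ℕ+ → ℝ) (F : Measure ℝ≥0) (G : ℕ+ → Measure ℝ≥0) (c : ℕ+ → ℕ)
    (P : ∀ n : ℕ+, Policy n (c n))
    (ν : ∀ n : ℕ+, (Fin n → ℝ≥0) → Measure (State n (c n))) : Prop where
  job_prob : IsProbabilityMeasure F
  job_mean : ∫⁻ w, (w : ℝ≥0∞) ∂F = 1
  arrival_prob : ∀ n, IsProbabilityMeasure (G n)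
  arrival_mean : ∀ n, ∫⁻ y, (y : ℝ≥0∞) ∂(G n) = ENNReal.ofReal (1 / (lam * (n : ℕ)))
  symmetric : ∀ n, (P n).WeaklySymmetric
  memory : (fun n : ℕ+ => (c n : ℝ)) =o[atTop] fun n : ℕ+ => Real.log (n : ℕ)
  message_pos : ∀ n, 0 < α n
  message_order : α =o[atTop] fun n : ℕ+ => ((n : ℕ) : ℝ) ^ 2
  initial_prob : ∀ n : ℕ+, ∀ μ ∈ rateSet n, IsProbabilityMeasure (ν n μ)
  initial_mem : ∀ n : ℕ+, ∀ μ ∈ rateSet n, ∀ᵐ x ∂(ν n μ), x ∈ stateSpace n (c n) (G n)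
  message_rate : ∀ n : ℕ+, ∀ μ ∈ rateSet n, ∀ᵐ x ∂(ν n μ), ∀ᵐ ω ∂(lawFrom (G n) F x.2.2),
    messageRate (P n) μ x ω ≤ ENNReal.ofReal (α n)

end Dispatch

namespace Dispatch

section

/-! ### Consequences of weak symmetry -/

/-! Once `2 ^ c < n`, there are fewer memory states than servers, and this makes weak symmetry
rigid. The relabellings that preserve the decision probabilities in a given memory state form a
subgroup of the symmetric group of index at most `2 ^ c < n`, and for `n ≥ 5` such a subgroup
contains the alternating group (`Policy.WeaklySymmetric.alternatingGroup_le`). So memory cannot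
single out servers: the queried set is uniform given its size, and unqueried servers are equally
likely destinations.

Let `N` be half of the servers, all slow. Given that `s ≤ n / 4` servers are queried, they all lie
in `N` with probability at least `4 ^ (-s)`, and the job then joins `N` with probability at least `1
/ 4`. Replacing the convex function `4 ^ (-s)` by its tangent at a point `x₀` yields a bound that is
affine in the mean number of queries and holds in every state
(`Policy.WeaklySymmetric.le_integral_send`). Affinity is essential: only a long-run average of the
messages is controlled, and an affine bound can be summed along the path.

The summation is a law of large numbers for bounded increments with nonnegative conditional mean
(`ae_eventually_le_sum`). Conditioning on the past is expressed by resampling the size and the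
routing variables of one job, which does not change the state that the job finds
(`AgreeOff.preState_eq`). With `x₀` of order `α / n`, jobs of size at least a fixed `w₀` bring work
to `N` at a rate of order `n * exp (-K * α / n)`, while `N` completes at most `ε * n` per unit time.
The condition `α = o(n ^ 2)` keeps `x₀` below `n / 4`. A workload that grows linearly rules out
Harris recurrence (`notMem_stabilityRegion`).

For the first part it is enough to remove one vector from the set of rates. Its slow half has rate
`exp (-(n + r))`, which is eventually below `a * exp (-(K * r / n))` whatever the constants, so the
vector need not depend on the job size law. -/

theorem alternatingGroup_le_of_index_lt {n : ℕ} (hn : 5 ≤ n) (H : Subgroup (Equiv.Perm (Fin n)))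
    (h : H.index < n) : alternatingGroup (Fin n) ≤ H := by
  -- The normal core is the kernel of the action on the cosets of `H`. Were it trivial, all
  -- permutations of `n` points would embed into those of fewer than `n` points. A nontrivial normal
  -- subgroup contains the alternating group when `n ≥ 5`.
  have hnt : Nontrivial H.normalCore := by
    rw [Subgroup.nontrivial_iff_ne_bot]
    intro hbot
    rw [Subgroup.normalCore_eq_ker, MonoidHom.ker_eq_bot_iff] at hbot
    have h1 := Nat.card_le_card_of_injective _ hbot
    rw [Nat.card_perm, Nat.card_perm, Nat.card_fin, ← Subgroup.index_eq_card] at h1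
    have h2 : H.index.factorial ≤ (n - 1).factorial := Nat.factorial_le (by omega)
    have h3 : (n - 1).factorial < n.factorial :=
      (Nat.factorial_lt (by omega)).2 (by omega)
    omega
  exact (Equiv.Perm.alternatingGroup_le_of_normal (by simpa using hn) hnt).trans H.normalCore_le

theorem Report.relabel_mul {n : ℕ} (σ τ : Equiv.Perm (Fin n)) (r : Report n) :
    r.relabel (σ * τ) = (r.relabel τ).relabel σ := rfl

/-- The domain of the partial function serves as `S`, and the values off it are irrelevant. Weak
symmetry thereby applies to arbitrary reports. -/
theorem Report.exists_eq_report {n : ℕ} (r : Report n) : ∃ q μ S, r = report q μ S := by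
  refine ⟨fun i => ((r i).getD ([], 0)).1, fun i => ((r i).getD ([], 0)).2,
    Finset.univ.filter fun i => r i ≠ none, ?_⟩
  funext i
  by_cases h : r i = none
  · simp [report, h]
  · obtain ⟨y, hy⟩ := Option.ne_none_iff_exists'.1 h
    simp [report, hy]

variable {n c : ℕ}

/-- The probability that the set `S` of servers is queried. -/
noncomputable def Policy.queryProb (P : Policy n c) (m : Fin (2 ^ c)) (w : ℝ≥0)
    (S : Finset (Fin n)) : ℝ≥0∞ :=
  volume {u : unitInterval | P.f₁ m w u = S}

/-- The probability that a job is sent to server `i`. -/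
noncomputable def Policy.sendProb (P : Policy n c) (m : Fin (2 ^ c)) (w : ℝ≥0) (r : Report n)
    (i : Fin n) : ℝ≥0∞ :=
  volume {v : unitInterval | P.f₂ m w r v = i}

theorem Policy.WeaklySymmetric.exists_perm {P : Policy n c} (hP : P.WeaklySymmetric)
    (σ : Equiv.Perm (Fin n)) : ∃ σM : Equiv.Perm (Fin (2 ^ c)), ∀ m w,
      (∀ S, P.queryProb m w S = P.queryProb (σM m) w (S.map σ.toEmbedding)) ∧
      ∀ r i, P.sendProb m w r i = P.sendProb (σM m) w (r.relabel σ) (σ i) := by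
  obtain ⟨σM, h1, h2⟩ := hP σ
  refine ⟨σM, fun m w => ⟨fun S => ?_, fun r i => ?_⟩⟩
  · have := h1 m w (S.map σ.toEmbedding)
    simpa only [Policy.queryProb, (Finset.map_injective σ.toEmbedding).eq_iff] using this
  · obtain ⟨q, μ, S, rfl⟩ := r.exists_eq_report
    have := h2 m w S q μ (σ i)
    simpa only [Policy.sendProb, σ.injective.eq_iff] using this

/-- The relabellings of the servers that preserve the decision probabilities in memory state `m`. -/
def Policy.symmetryGroup (P : Policy n c) (m : Fin (2 ^ c)) : Subgroup (Equiv.Perm (Fin n)) where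
  carrier := {σ | ∀ w, (∀ S, P.queryProb m w S = P.queryProb m w (S.map σ.toEmbedding)) ∧
      ∀ r i, P.sendProb m w r i = P.sendProb m w (r.relabel σ) (σ i)}
  mul_mem' := by
    intro σ τ hσ hτ w
    refine ⟨fun S => ?_, fun r i => ?_⟩
    · rw [(hτ w).1, (hσ w).1, Finset.map_map]; rfl
    · rw [(hτ w).2, (hσ w).2]; rfl
  one_mem' := by
    intro w
    refine ⟨fun S => ?_, fun r i => rfl⟩
    exact congrArg _ Finset.map_refl.symm
  inv_mem' := by
    intro σ hσ w
    refine ⟨fun S => ?_, fun r i => ?_⟩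
    · rw [(hσ w).1 (S.map (σ⁻¹).toEmbedding), Finset.map_map]
      congr 1
      ext; simp
    · rw [(hσ w).2 (r.relabel σ⁻¹), ← Report.relabel_mul]
      have h1 : σ (σ⁻¹ i) = i := σ.apply_symm_apply i
      rw [mul_inv_cancel, h1]
      rfl

/-- The map `σ ↦ M σ m` separates left cosets of the symmetry group: two relabellings that lead to
the same memory state differ by one that preserves the probabilities in `m`. The choice `M` need not
be a homomorphism. -/
theorem Policy.WeaklySymmetric.index_symmetryGroup_le {P : Policy n c} (hP : P.WeaklySymmetric)
    (m : Fin (2 ^ c)) : (P.symmetryGroup m).index ≤ 2 ^ c := by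
  choose M hM using fun σ => hP.exists_perm σ
  rw [Subgroup.index_eq_card]
  have key : Function.Injective
      fun x : Equiv.Perm (Fin n) ⧸ P.symmetryGroup m => M x.out m := by
    intro x y hxy
    rw [← x.out_eq', ← y.out_eq']
    refine (QuotientGroup.eq.2 ?_).symm
    intro w
    have hx := hM x.out m w
    have hy := hM y.out m w
    simp only at hxy
    refine ⟨fun S => ?_, fun r i => ?_⟩
    · rw [hx.1, hxy, hy.1, Finset.map_map]
      congr 1
      have h1 : (y.out⁻¹ * x.out).toEmbedding.trans y.out.toEmbedding = x.out.toEmbedding := by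
        ext; simp
      rw [h1]
    · rw [hx.2, hxy, hy.2, ← Report.relabel_mul]
      simp
  simpa using Nat.card_le_card_of_injective _ key

theorem Policy.WeaklySymmetric.alternatingGroup_le {P : Policy n c} (hP : P.WeaklySymmetric)
    (hn : 5 ≤ n) (hc : 2 ^ c < n) (m : Fin (2 ^ c)) :
    alternatingGroup (Fin n) ≤ P.symmetryGroup m :=
  alternatingGroup_le_of_index_lt hn _ ((hP.index_symmetryGroup_le m).trans_lt hc)

/-- The set of queried servers is uniformly distributed given its size. -/
theorem Policy.WeaklySymmetric.queryProb_eq {P : Policy n c} (hP : P.WeaklySymmetric)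
    (hn : 5 ≤ n) (hc : 2 ^ c < n) (m : Fin (2 ^ c)) (w : ℝ≥0) {S T : Finset (Fin n)}
    (h : S.card = T.card) : P.queryProb m w S = P.queryProb m w T := by
  -- Even permutations already act transitively on the subsets of a given size.
  have := Set.powersetCard.isPretransitive_alternatingGroup (α := Fin n) (n := T.card)
    (by rw [Nat.card_fin]; omega)
  obtain ⟨g, hg⟩ := this.exists_smul_eq ⟨S, h⟩ ⟨T, rfl⟩
  have hS : S.map (g : Equiv.Perm (Fin n)).toEmbedding = T := by
    have := congrArg Subtype.val hg
    rw [Finset.map_eq_image]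
    exact this
  rw [((hP.alternatingGroup_le hn hc m g.2) w).1 S, hS]

/-- A job that is not sent to a queried server is sent to a uniformly chosen other server. -/
theorem Policy.WeaklySymmetric.sendProb_eq {P : Policy n c} (hP : P.WeaklySymmetric)
    (hn : 5 ≤ n) (hc : 2 ^ c < n) (m : Fin (2 ^ c)) (w : ℝ≥0) {S : Finset (Fin n)}
    (hS : S.card + 3 ≤ n) (q : Fin n → Queue) (μ : Fin n → ℝ≥0) {i j : Fin n} (hi : i ∉ S)
    (hj : j ∉ S) : P.sendProb m w (report q μ S) i = P.sendProb m w (report q μ S) j := by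
  rcases eq_or_ne i j with rfl | hij
  · rfl
  -- A third unqueried server allows an even permutation to take `i` to `j` while fixing `S`
  -- pointwise; this is why three servers must remain outside `S`.
  obtain ⟨k, hk⟩ : ∃ k, k ∉ insert i (insert j S) := by
    by_contra! hall
    have h1 : Finset.univ ⊆ insert i (insert j S) := fun x _ => hall x
    have h2 := Finset.card_le_card h1
    have h3 := Finset.card_insert_le i (insert j S)
    have h4 := Finset.card_insert_le j S
    rw [Finset.card_fin] at h2
    omega
  simp only [Finset.mem_insert, not_or] at hk
  obtain ⟨hki, hkj, hkS⟩ := hk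
  have hrel : ∀ τ : Equiv.Perm (Fin n), (∀ x, x ∈ S → τ.symm x = x) →
      (report q μ S).relabel τ = report q μ S := by
    intro τ hτ
    funext x
    by_cases hx : x ∈ S
    · simp [Report.relabel, report, hτ x hx]
    · have : τ.symm x ∉ S := by
        intro h
        have h2 := hτ _ h
        rw [τ.symm.injective h2] at h
        exact hx h
      simp [Report.relabel, report, hx, this]
  let τ : Equiv.Perm (Fin n) := Equiv.swap i k * Equiv.swap i j
  have hτ : τ ∈ alternatingGroup (Fin n) :=
    Equiv.Perm.mul_mem_alternatingGroup_of_isSwap ⟨i, k, Ne.symm hki, rfl⟩ ⟨i, j, hij, rfl⟩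
  have hτi : τ i = j := by
    simp [τ, Equiv.swap_apply_of_ne_of_ne, hij.symm, Ne.symm hkj]
  have hfix : ∀ x, x ∈ S → τ.symm x = x := by
    intro x hx
    have h1 : x ≠ i := fun h => hi (h ▸ hx)
    have h2 : x ≠ j := fun h => hj (h ▸ hx)
    have h3 : x ≠ k := fun h => hkS (h ▸ hx)
    rw [Equiv.symm_apply_eq]
    simp [τ, Equiv.swap_apply_of_ne_of_ne, h1, h2, h3]
  have := ((hP.alternatingGroup_le hn hc m hτ) w).2 (report q μ S) i
  rw [this, hrel τ hfix, hτi]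

end

section

/-! ### The probability that a job is sent to a given half of the servers -/

/-- Falling factorials are compared factor by factor: `n - j ≤ 4 * (k - j)` as long as `4 * (j + 1)
≤ n`. -/
theorem choose_le_four_pow_mul_choose {n k s : ℕ} (hk : n ≤ 2 * k + 1) (hn : 8 ≤ n)
    (hs : 4 * s ≤ n) : n.choose s ≤ 4 ^ s * k.choose s := by
  have hdesc : ∀ j, 4 * j ≤ n → n.descFactorial j ≤ 4 ^ j * k.descFactorial j := by
    intro j
    induction j with
    | zero => simp
    | succ j ih =>
      intro hj
      have h1 := ih (by omega)
      rw [Nat.descFactorial_succ, Nat.descFactorial_succ]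
      calc (n - j) * n.descFactorial j
          ≤ (4 * (k - j)) * (4 ^ j * k.descFactorial j) := Nat.mul_le_mul (by omega) h1
        _ = 4 ^ (j + 1) * ((k - j) * k.descFactorial j) := by ring
  have h := hdesc s hs
  rw [Nat.descFactorial_eq_factorial_mul_choose, Nat.descFactorial_eq_factorial_mul_choose] at h
  refine Nat.le_of_mul_le_mul_left (?_ : s.factorial * _ ≤ s.factorial * _) s.factorial_pos
  calc _ ≤ _ := h
    _ = _ := by ring

/-- The weights depend on the size only, so the comparison is made size by size; a uniform
`s`-subset lies in `N` with probability `N.card.choose s / n.choose s`, which is at least `4 ^ (-s)`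
when `4 * s ≤ n`. -/
theorem sum_mul_le_sum_powerset {n : ℕ} (hn : 8 ≤ n) {N : Finset (Fin n)} (hN : N.card = n / 2)
    {p : Finset (Fin n) → ℝ} (hp : ∀ S, 0 ≤ p S)
    (hsym : ∀ S T : Finset (Fin n), S.card = T.card → p S = p T) :
    ∑ S, p S * (if 4 * S.card ≤ n then (1 / 4 : ℝ) ^ S.card else 0) ≤
      ∑ S, p S * (if S ⊆ N ∧ 4 * S.card ≤ n then 1 else 0) := by
  have hr : ∑ S, p S * (if S ⊆ N ∧ 4 * S.card ≤ n then (1 : ℝ) else 0) =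
      ∑ S ∈ N.powerset, p S * (if 4 * S.card ≤ n then 1 else 0) := by
    rw [← Finset.sum_filter_add_sum_filter_not Finset.univ (fun S => S ⊆ N)]
    rw [Finset.sum_eq_zero (s := Finset.univ.filter fun S => ¬ S ⊆ N), add_zero]
    · refine Finset.sum_congr ?_ fun S hS => ?_
      · ext S; simp
      · simp only [Finset.mem_powerset] at hS
        simp [hS]
    · intro S hS
      simp only [Finset.mem_filter] at hS
      simp [hS.2]
  rw [hr, ← Finset.powerset_univ, Finset.sum_powerset, Finset.sum_powerset, Finset.card_fin]
  have hsub : Finset.range (N.card + 1) ⊆ Finset.range (n + 1) := by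
    intro s hs
    simp only [Finset.mem_range] at hs ⊢
    omega
  rw [← Finset.sum_subset hsub]
  · refine Finset.sum_le_sum fun s hs => ?_
    simp only [Finset.mem_range] at hs
    obtain ⟨S₀, -, hS₀⟩ := Finset.exists_subset_card_eq (show s ≤ N.card by omega)
    have h1 : ∀ T : Finset (Fin n), (∀ x : ℕ → ℝ, ∑ S ∈ T.powersetCard s, p S * x S.card =
        (T.card.choose s : ℝ) * (p S₀ * x s)) := by
      intro T x
      rw [Finset.sum_congr rfl (g := fun _ => p S₀ * x s), Finset.sum_const,
        Finset.card_powersetCard, nsmul_eq_mul]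
      intro S hS
      rw [Finset.mem_powersetCard] at hS
      rw [hsym S S₀ (by rw [hS.2, hS₀]), hS.2]
    rw [h1 Finset.univ fun s => if 4 * s ≤ n then (1 / 4 : ℝ) ^ s else 0,
      h1 N fun s => if 4 * s ≤ n then (1 : ℝ) else 0, Finset.card_fin]
    split_ifs with h4
    · have hc : (n.choose s : ℝ) ≤ 4 ^ s * (N.card.choose s : ℝ) := by
        exact_mod_cast choose_le_four_pow_mul_choose (by omega) hn h4
      have h5 : (n.choose s : ℝ) * (1 / 4) ^ s ≤ N.card.choose s := by
        rw [one_div, inv_pow, ← div_eq_mul_inv, div_le_iff₀ (by positivity)]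
        linarith
      calc _ = p S₀ * ((n.choose s : ℝ) * (1 / 4) ^ s) := by ring
        _ ≤ p S₀ * N.card.choose s := mul_le_mul_of_nonneg_left h5 (hp _)
        _ = _ := by ring
    · simp
  · intro s _ hs
    refine Finset.sum_eq_zero fun S hS => ?_
    rw [Finset.mem_powersetCard] at hS
    simp only [Finset.mem_range] at hs
    rw [if_neg (by omega), mul_zero]

theorem integral_comp_eq_sum {ι : Type*} [Fintype ι] [MeasurableSpace ι]
    [MeasurableSingletonClass ι] {g : unitInterval → ι} (hg : Measurable g) (h : ι → ℝ) :
    ∫ u, h (g u) = ∑ i, (volume {u : unitInterval | g u = i}).toReal * h i := by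
  have hh : Measurable h := measurable_of_countable h
  have : IsProbabilityMeasure (Measure.map g volume) := Measure.isProbabilityMeasure_map hg.aemeasurable
  rw [← integral_map hg.aemeasurable hh.aestronglyMeasurable, integral_fintype .of_finite]
  refine Finset.sum_congr rfl fun i _ => ?_
  rw [measureReal_def, Measure.map_apply hg (measurableSet_singleton i), smul_eq_mul]
  rfl

variable {n c : ℕ}

theorem Policy.measurable_f₁_apply (P : Policy n c) (m : Fin (2 ^ c)) (w : ℝ≥0) :
    Measurable (P.f₁ m w) :=
  P.measurable_f₁.comp (measurable_const.prodMk (measurable_const.prodMk measurable_id))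

theorem Policy.measurable_f₂_apply (P : Policy n c) (m : Fin (2 ^ c)) (w : ℝ≥0) (r : Report n) :
    Measurable (P.f₂ m w r) :=
  P.measurable_f₂.comp (measurable_const.prodMk
    (measurable_const.prodMk (measurable_const.prodMk measurable_id)))

theorem Policy.sum_queryProb (P : Policy n c) (m : Fin (2 ^ c)) (w : ℝ≥0) :
    ∑ S, (P.queryProb m w S).toReal = 1 := by
  have := integral_comp_eq_sum (P.measurable_f₁_apply m w) fun _ => 1
  simpa [Policy.queryProb] using this.symm

theorem Policy.sum_sendProb (P : Policy n c) (m : Fin (2 ^ c)) (w : ℝ≥0) (r : Report n) :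
    ∑ i, (P.sendProb m w r i).toReal = 1 := by
  have := integral_comp_eq_sum (P.measurable_f₂_apply m w r) fun _ => 1
  simpa [Policy.sendProb] using this.symm

/-- The mass on `S` counts in full because `S ⊆ N`, and the rest is spread evenly over the unqueried
servers, of which at least a quarter lie in `N`. -/
theorem Policy.WeaklySymmetric.quarter_le_sum_sendProb {P : Policy n c} (hP : P.WeaklySymmetric)
    (hn : 8 ≤ n) (hc : 2 ^ c < n) (m : Fin (2 ^ c)) (w : ℝ≥0) (q : Fin n → Queue)
    (μ : Fin n → ℝ≥0) {N S : Finset (Fin n)} (hN : N.card = n / 2) (hSN : S ⊆ N)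
    (hS : 4 * S.card ≤ n) :
    1 / 4 ≤ ∑ i ∈ N, (P.sendProb m w (report q μ S) i).toReal := by
  set f : Fin n → ℝ := fun i => (P.sendProb m w (report q μ S) i).toReal with hf
  have hf0 : ∀ i, 0 ≤ f i := fun i => ENNReal.toReal_nonneg
  obtain ⟨j, hjN, hjS⟩ : ∃ j ∈ N, j ∉ S :=
    Finset.exists_mem_notMem_of_card_lt_card (by omega)
  have hout : ∀ i, i ∉ S → f i = f j := fun i hi => by
    simp only [hf]
    rw [hP.sendProb_eq (by omega) hc m w (by omega) q μ hi hjS]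
  have htot : ∑ i, f i = ∑ i ∈ S, f i + (n - S.card : ℝ) * f j := by
    rw [← Finset.sum_add_sum_compl S f, Finset.sum_congr rfl (g := fun _ => f j) (s₁ := Sᶜ)
      (fun i hi => hout i (by simpa using hi)), Finset.sum_const, Finset.card_compl,
      nsmul_eq_mul, Fintype.card_fin, Nat.cast_sub (by omega)]
  have hNsum : ∑ i ∈ N, f i = ∑ i ∈ S, f i + (N.card - S.card : ℝ) * f j := by
    rw [← Finset.sum_sdiff hSN, add_comm, Finset.sum_congr rfl (g := fun _ => f j) (s₁ := N \ S)
      (fun i hi => hout i (Finset.mem_sdiff.1 hi).2), Finset.sum_const,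
      Finset.card_sdiff_of_subset hSN, nsmul_eq_mul, Nat.cast_sub (Finset.card_le_card hSN)]
  have h1 : ∑ i, f i = 1 := P.sum_sendProb m w _
  have h2 : 0 ≤ ∑ i ∈ S, f i := Finset.sum_nonneg fun i _ => hf0 i
  -- Equivalent to `n - S.card ≤ 4 * (N.card - S.card)`. Rounding in `n / 2` costs up to `2`, which
  -- `8 ≤ n` absorbs.
  have h3 : (n : ℝ) + 3 * S.card ≤ 4 * N.card := by
    have : n + 3 * S.card ≤ 4 * N.card := by omega
    exact_mod_cast this
  rw [hNsum]
  rw [htot] at h1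
  nlinarith [mul_nonneg (sub_nonneg.2 h3) (hf0 j)]

theorem one_lt_log_four : 1 < Real.log 4 := by
  have h : Real.log 4 = 2 * Real.log 2 := by
    rw [show (4 : ℝ) = 2 ^ 2 by norm_num, Real.log_pow]; norm_num
  have := Real.log_two_gt_d9
  rw [h]; linarith

/-- The left side is the tangent at `x₀` of the convex function `4 ^ (-s)`. The truncation for `4 *
s > n` is harmless, since there `s > x₀ + 1` and `log 4 > 1` make the tangent negative. -/
theorem tangent_le {n s : ℕ} {x₀ : ℝ} (hx : x₀ + 1 ≤ n / 4) :
    Real.exp (-(Real.log 4 * x₀)) * (1 + Real.log 4 * (x₀ - s)) ≤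
      if 4 * s ≤ n then (1 / 4 : ℝ) ^ s else 0 := by
  split_ifs with h
  · have h1 : (1 / 4 : ℝ) ^ s = Real.exp (-(Real.log 4 * x₀)) * Real.exp (Real.log 4 * (x₀ - s)) := by
      rw [← Real.exp_add, show -(Real.log 4 * x₀) + Real.log 4 * (x₀ - s) = s * -Real.log 4 by ring,
        Real.exp_nat_mul, Real.exp_neg, Real.exp_log (by norm_num), one_div]
    rw [h1]
    refine mul_le_mul_of_nonneg_left ?_ (Real.exp_pos _).le
    linarith [Real.add_one_le_exp (Real.log 4 * (x₀ - s))]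
  · refine mul_nonpos_of_nonneg_of_nonpos (Real.exp_pos _).le ?_
    have h2 : (n : ℝ) + 1 ≤ 4 * s := by
      have : n + 1 ≤ 4 * s := by omega
      exact_mod_cast this
    nlinarith [one_lt_log_four]

/-- Lower bound for the probability that a job is sent to a set `N` of half of the servers, in terms
of the mean number of queried servers. -/
theorem Policy.WeaklySymmetric.le_integral_send {P : Policy n c} (hP : P.WeaklySymmetric)
    (hn : 8 ≤ n) (hc : 2 ^ c < n) (m : Fin (2 ^ c)) (w : ℝ≥0) (q : Fin n → Queue)
    (μ : Fin n → ℝ≥0) {N : Finset (Fin n)} (hN : N.card = n / 2) {x₀ : ℝ} (hx : x₀ + 1 ≤ n / 4) :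
    Real.exp (-(Real.log 4 * x₀)) / 4 * (1 + Real.log 4 * x₀) ≤
      ∫ u, ((∫ v, (if P.f₂ m w (report q μ (P.f₁ m w u)) v ∈ N then (1 : ℝ) else 0)) +
        Real.exp (-(Real.log 4 * x₀)) / 4 * Real.log 4 * (P.f₁ m w u).card) := by
  set L := Real.log 4
  set E := Real.exp (-(L * x₀)) with hE
  set p : Finset (Fin n) → ℝ := fun S => (P.queryProb m w S).toReal with hp
  have hp0 : ∀ S, 0 ≤ p S := fun S => ENNReal.toReal_nonneg
  have hinner : ∀ S : Finset (Fin n),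
      (if S ⊆ N ∧ 4 * S.card ≤ n then (1 : ℝ) else 0) / 4 ≤
      ∫ v, (if P.f₂ m w (report q μ S) v ∈ N then (1 : ℝ) else 0) := by
    intro S
    split_ifs with h
    · rw [integral_comp_eq_sum (P.measurable_f₂_apply m w (report q μ S))
        fun i => if i ∈ N then (1 : ℝ) else 0]
      simp only [mul_ite, mul_one, mul_zero]
      rw [← Finset.sum_filter, Finset.filter_mem_eq_inter, Finset.univ_inter]
      exact hP.quarter_le_sum_sendProb hn hc m w q μ hN h.1 h.2
    · rw [zero_div]
      exact integral_nonneg fun v => by positivity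
  rw [integral_comp_eq_sum (P.measurable_f₁_apply m w) fun S =>
    (∫ v, (if P.f₂ m w (report q μ S) v ∈ N then (1 : ℝ) else 0)) + E / 4 * L * S.card]
  change _ ≤ ∑ S, p S * _
  have hA := sum_mul_le_sum_powerset hn hN hp0 fun S T h => by
    simp only [hp]; rw [hP.queryProb_eq (by omega) hc m w h]
  calc E / 4 * (1 + L * x₀) = ∑ S, p S * (E / 4 * (1 + L * x₀)) := by
        rw [← Finset.sum_mul, P.sum_queryProb, one_mul]
    -- The tangent bound is used under the average over the queried set; its part linear in `S.card`
    -- becomes the query term of the statement.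
    _ ≤ ∑ S, (p S * (if 4 * S.card ≤ n then (1 / 4 : ℝ) ^ S.card else 0) / 4 +
          p S * (E / 4 * L * S.card)) := by
        refine Finset.sum_le_sum fun S _ => ?_
        have := mul_le_mul_of_nonneg_left (tangent_le (s := S.card) hx) (hp0 S)
        change p S * (E * (1 + L * (x₀ - S.card))) ≤ _ at this
        linarith
    _ = (∑ S, p S * (if 4 * S.card ≤ n then (1 / 4 : ℝ) ^ S.card else 0)) / 4 +
          ∑ S, p S * (E / 4 * L * S.card) := by
        rw [Finset.sum_add_distrib, Finset.sum_div]
    _ ≤ (∑ S, p S * (if S ⊆ N ∧ 4 * S.card ≤ n then 1 else 0)) / 4 +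
          ∑ S, p S * (E / 4 * L * S.card) := by linarith
    _ = ∑ S, p S * ((if S ⊆ N ∧ 4 * S.card ≤ n then 1 else 0) / 4 + E / 4 * L * S.card) := by
        rw [Finset.sum_div, ← Finset.sum_add_distrib]
        exact Finset.sum_congr rfl fun S _ => by ring
    _ ≤ _ := Finset.sum_le_sum fun S _ =>
        mul_le_mul_of_nonneg_left (by linarith [hinner S]) (hp0 S)

end

/-! ### Measurability of the sample paths -/

section Measurability

variable {n c : ℕ} {α : Type*} [MeasurableSpace α]

/-- Random servers, query sets and event counters take countably many values, so measurability needs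
checking only for each fixed value. -/
theorem measurable_comp_index {ι β : Type*} [Countable ι] [MeasurableSpace ι]
    [MeasurableSingletonClass ι] [MeasurableSpace β] {f : ι → α → β} {g : α → ι}
    (hf : ∀ i, Measurable (f i)) (hg : Measurable g) : Measurable fun a => f (g a) a := by
  have h : Measurable fun x : ι × α => f x.1 x.2 := measurable_from_prod_countable_right hf
  exact h.comp (hg.prodMk measurable_id)

theorem measurable_queue_iff {f : α → Queue} :
    Measurable f ↔ (Measurable fun a => (f a).length) ∧
      ∀ j, Measurable fun a => (f a).getD j 0 := by
  rw [measurable_comap_iff]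
  constructor
  · intro h
    exact ⟨measurable_fst.comp h, fun j => (measurable_pi_apply j).comp (measurable_snd.comp h)⟩
  · rintro ⟨h1, h2⟩
    exact h1.prodMk (measurable_pi_lambda _ h2)

theorem measurable_serve {x : α → ℝ≥0} {q : α → Queue} (hx : Measurable x) (hq : Measurable q) :
    Measurable fun a => serve (x a) (q a) := by
  obtain ⟨h1, h2⟩ := measurable_queue_iff.1 hq
  refine measurable_queue_iff.2 ⟨?_, fun j => ?_⟩
  · convert h1 using 2 with a
    cases q a <;> rfl
  · cases j with
    | zero =>
      -- Padding by zeros agrees with truncated subtraction, so the formula also covers an idle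
      -- server.
      have h : ∀ a, (serve (x a) (q a)).getD 0 0 = (q a).getD 0 0 - x a := by
        intro a
        cases q a with
        | nil => exact (zero_tsub _).symm
        | cons w l => rfl
      simp only [h]
      exact (h2 0).sub hx
    | succ j =>
      convert h2 (j + 1) using 2 with a
      cases q a <;> simp [serve]

theorem measurable_append_singleton {w : α → ℝ≥0} {q : α → Queue} (hw : Measurable w)
    (hq : Measurable q) : Measurable fun a => q a ++ [w a] := by
  obtain ⟨h1, h2⟩ := measurable_queue_iff.1 hq
  refine measurable_queue_iff.2 ⟨?_, fun j => ?_⟩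
  · simp only [List.length_append, List.length_singleton]
    exact h1.add_const 1
  · have h : ∀ a, (q a ++ [w a]).getD j 0 =
        if j < (q a).length then (q a).getD j 0 else if j = (q a).length then w a else 0 := by
      intro a
      split_ifs with h3 h4
      · rw [List.getD_append _ _ _ _ h3]
      · rw [List.getD_append_right _ _ _ _ h4.ge, h4, Nat.sub_self]; rfl
      · rw [List.getD_eq_default]
        simp only [List.length_append, List.length_singleton]
        omega
    simp only [h]
    exact Measurable.ite (h1 (measurableSet_Ioi (a := j))) (h2 j)
      (Measurable.ite (measurableSet_eq_fun measurable_const h1) hw measurable_const)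

theorem measurable_tail {q : α → Queue} (hq : Measurable q) : Measurable fun a => (q a).tail := by
  obtain ⟨h1, h2⟩ := measurable_queue_iff.1 hq
  refine measurable_queue_iff.2 ⟨?_, fun j => ?_⟩
  · simp only [List.length_tail]
    exact (measurable_of_countable fun k : ℕ => k - 1).comp h1
  · convert h2 (j + 1) using 2 with a
    cases q a <;> simp

theorem measurable_queue_sum : Measurable fun q : Queue => q.sum := by
  have hid : Measurable fun q : Queue => q := measurable_id
  obtain ⟨h1, h2⟩ := measurable_queue_iff.1 hid
  have h : ∀ q : Queue, q.sum = ∑ j ∈ Finset.range q.length, q.getD j 0 := by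
    intro q
    induction q with
    | nil => simp
    | cons w l ih =>
      rw [List.sum_cons, ih, List.length_cons, Finset.sum_range_succ']
      exact add_comm _ _
  simp only [h]
  exact measurable_comp_index (f := fun k (q : Queue) => ∑ j ∈ Finset.range k, q.getD j 0)
    (fun k => Finset.measurable_sum _ fun j _ => h2 j) h1

theorem measurable_completionDelay (r : ℝ≥0) {q : α → Queue} (hq : Measurable q) :
    Measurable fun a => completionDelay r (q a) := by
  obtain ⟨h1, h2⟩ := measurable_queue_iff.1 hq
  have h : ∀ a, completionDelay r (q a) =
      if (q a).length = 0 then ⊤ else ((q a).getD 0 0 : ℝ≥0∞) / (r : ℝ≥0∞) := by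
    intro a
    cases q a <;> rfl
  simp only [h]
  exact Measurable.ite (measurableSet_eq_fun h1 measurable_const) measurable_const
    ((h2 0).coe_nnreal_ennreal.div measurable_const)

theorem measurable_some {β : Type*} [MeasurableSpace β] : Measurable (some : β → Option β) :=
  fun _ hs => hs

instance instMeasurableSingletonClassOption {β : Type*} [MeasurableSpace β]
    [MeasurableSingletonClass β] : MeasurableSingletonClass (Option β) where
  measurableSet_singleton x := by
    change MeasurableSet (some ⁻¹' {x})
    cases x with
    | none => convert MeasurableSet.empty; ext; simp
    | some y => convert measurableSet_singleton y; ext; simp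

theorem measurable_report {q : α → Fin n → Queue} {S : α → Finset (Fin n)} (μ : Fin n → ℝ≥0)
    (hq : Measurable q) (hS : Measurable S) : Measurable fun a => report (q a) μ (S a) := by
  refine measurable_comp_index (f := fun S a => report (q a) μ S) (fun S => ?_) hS
  refine measurable_pi_lambda _ fun i => ?_
  by_cases hi : i ∈ S
  · simp only [report, if_pos hi]
    exact measurable_some.comp (((measurable_pi_apply i).comp hq).prodMk measurable_const)
  · simp only [report, if_neg hi]
    exact measurable_const

theorem measurable_apply_index {β : Type*} [MeasurableSpace β] {q : α → Fin n → β} {D : α → Fin n}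
    (hq : Measurable q) (hD : Measurable D) : Measurable fun a => q a (D a) :=
  measurable_comp_index (f := fun i a => q a i) (fun i => (measurable_pi_apply i).comp hq) hD

theorem measurable_update_index {β : Type*} [MeasurableSpace β] {q : α → Fin n → β}
    {D : α → Fin n} {y : α → β} (hq : Measurable q) (hD : Measurable D) (hy : Measurable y) :
    Measurable fun a => Function.update (q a) (D a) (y a) := by
  refine measurable_comp_index (f := fun i a => Function.update (q a) i (y a)) (fun i => ?_) hD
  refine measurable_pi_lambda _ fun j => ?_
  by_cases h : j = i
  · subst h; simpa using hy
  · simp only [Function.update_of_ne h]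
    exact (measurable_pi_apply j).comp hq

theorem measurable_list_find {ι : Type*} [MeasurableSpace ι] {p : α → ι → Bool}
    (hp : ∀ i, Measurable fun a => p a i) (l : List ι) : Measurable fun a => l.find? (p a) := by
  induction l with
  | nil => simp
  | cons i l ih =>
    have h : ∀ a, (i :: l).find? (p a) = if p a i = true then some i else l.find? (p a) := by
      intro a; cases h : p a i <;> simp [h]
    simp only [h]
    exact Measurable.ite (measurableSet_eq_fun (hp i) measurable_const) measurable_const ih

/-! #### Fundamental processes -/

theorem measurable_arrivalTime (z : ℝ≥0) {ω : α → Sample} {k : α → ℕ} (hω : Measurable ω)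
    (hk : Measurable k) : Measurable fun a => arrivalTime z (ω a) (k a) := by
  refine measurable_comp_index (f := fun k a => arrivalTime z (ω a) k) (fun k => ?_) hk
  exact (Finset.measurable_sum _ fun j _ =>
    (measurable_pi_apply j).comp (measurable_fst.comp hω)).sub_const z

theorem measurable_messageTime (β : ℝ≥0) {ω : α → Sample} {k : α → ℕ} (hω : Measurable ω)
    (hk : Measurable k) : Measurable fun a => messageTime β (ω a) (k a) := by
  refine measurable_comp_index (f := fun k a => messageTime β (ω a) k) (fun k => ?_) hk
  exact (Finset.measurable_sum _ fun j _ => (measurable_pi_apply j).comp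
    (measurable_fst.comp (measurable_snd.comp hω))).coe_nnreal_ennreal.div measurable_const

theorem measurable_jobSize {ω : α → Sample} {k : α → ℕ} (hω : Measurable ω)
    (hk : Measurable k) : Measurable fun a => jobSize (ω a) (k a) := by
  refine measurable_comp_index (f := fun k a => jobSize (ω a) k) (fun k => ?_) hk
  exact (measurable_pi_apply k).comp (measurable_fst.comp (measurable_snd.comp
    (measurable_snd.comp hω)))

theorem measurable_unif {ω : α → Sample} {k : α → ℕ} (i : Fin 8) (hω : Measurable ω)
    (hk : Measurable k) : Measurable fun a => unif (ω a) i (k a) := by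
  refine measurable_comp_index (f := fun k a => unif (ω a) i k) (fun k => ?_) hk
  exact (measurable_pi_apply k).comp ((measurable_pi_apply i).comp (measurable_snd.comp
    (measurable_snd.comp (measurable_snd.comp hω))))

/-! #### Configurations -/

/-- Pulled back from the tuple of fields, so that measurability is checked field by field. -/
instance instMeasurableSpaceConfig : MeasurableSpace (Config n c) :=
  MeasurableSpace.comap (fun C => (C.time, C.state, C.arr, C.spon, C.dep, C.msgs)) inferInstance

theorem measurable_config_iff {C : α → Config n c} :
    Measurable C ↔ (Measurable fun a => (C a).time) ∧ (Measurable fun a => (C a).state) ∧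
      (Measurable fun a => (C a).arr) ∧ (Measurable fun a => (C a).spon) ∧
      (Measurable fun a => (C a).dep) ∧ (Measurable fun a => (C a).msgs) := by
  rw [measurable_comap_iff]
  constructor
  · intro h
    exact ⟨h.fst, h.snd.fst, h.snd.snd.fst, h.snd.snd.snd.fst, h.snd.snd.snd.snd.fst,
      h.snd.snd.snd.snd.snd⟩
  · rintro ⟨h1, h2, h3, h4, h5, h6⟩
    exact h1.prodMk (h2.prodMk (h3.prodMk (h4.prodMk (h5.prodMk h6))))

theorem measurable_flow (μ : Fin n → ℝ≥0) {d : α → ℝ≥0} {s : α → State n c} (hd : Measurable d)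
    (hs : Measurable s) : Measurable fun a => flow μ (d a) (s a) :=
  (measurable_pi_lambda _ fun i => measurable_serve (hd.const_mul (μ i))
    ((measurable_pi_apply i).comp hs.fst)).prodMk (hs.snd.fst.prodMk (hs.snd.snd.add hd))

variable (P : Policy n c) (μ : Fin n → ℝ≥0)

theorem measurable_onArrival {ω : α → Sample} {t : α → ℝ≥0} {C : α → Config n c}
    (hω : Measurable ω) (ht : Measurable t) (hC : Measurable C) :
    Measurable fun a => onArrival P μ (ω a) (t a) (C a) := by
  obtain ⟨h1, h2, h3, h4, h5, h6⟩ := measurable_config_iff.1 hC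
  have hs := measurable_flow μ (ht.sub h1) h2
  have hw := measurable_jobSize hω h3
  have hS := P.measurable_f₁.comp (hs.snd.fst.prodMk (hw.prodMk (measurable_unif 0 hω h3)))
  have hr := measurable_report μ hs.fst hS
  have hD := P.measurable_f₂.comp
    (hs.snd.fst.prodMk (hw.prodMk (hr.prodMk (measurable_unif 1 hω h3))))
  have hM := P.measurable_f₃.comp
    (hs.snd.fst.prodMk (hw.prodMk (hr.prodMk (hD.prodMk (measurable_unif 2 hω h3)))))
  refine measurable_config_iff.2 ⟨ht, ?_, h3.add_const 1, h4, h5, ?_⟩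
  · exact (measurable_update_index hs.fst hD (measurable_append_singleton hw
      (measurable_apply_index hs.fst hD))).prodMk (hM.prodMk measurable_const)
  · exact h6.add ((measurable_of_countable fun S : Finset (Fin n) => 2 * S.card).comp hS)

theorem measurable_onMessage {ω : α → Sample} {t : α → ℝ≥0} {C : α → Config n c}
    (hω : Measurable ω) (ht : Measurable t) (hC : Measurable C) :
    Measurable fun a => onMessage P μ (ω a) (t a) (C a) := by
  obtain ⟨h1, h2, h3, h4, h5, h6⟩ := measurable_config_iff.1 hC
  have hs := measurable_flow μ (ht.sub h1) h2
  have hg := P.measurable_g₁.comp (hs.fst.prodMk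
    ((measurable_const (a := μ)).prodMk (measurable_unif 3 hω h4)))
  -- The sender takes finitely many values; fixing it resolves the `match`.
  refine measurable_comp_index (g := fun a => P.g₁ (flow μ (t a - (C a).time) (C a).state).1 μ
    (unif (ω a) 3 (C a).spon)) (f := fun o a =>
    let s := flow μ (t a - (C a).time) (C a).state
    let q := s.1
    let m := s.2.1
    match o with
    | none => { C a with time := t a, state := s, spon := (C a).spon + 1 }
    | some i =>
      let S := P.g₂ m i (q i) (μ i) (unif (ω a) 4 (C a).spon)
      { time := t a
        state := (q, P.g₃ m i (q i) (μ i) (report q μ S) (unif (ω a) 5 (C a).spon), s.2.2)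
        arr := (C a).arr
        spon := (C a).spon + 1
        dep := (C a).dep
        msgs := (C a).msgs + (1 + 2 * S.card) }) (fun o => ?_) hg
  cases o with
  | none => exact measurable_config_iff.2 ⟨ht, hs, h3, h4.add_const 1, h5, h6⟩
  | some i =>
    have hqi := (measurable_pi_apply i).comp hs.fst
    have hS := P.measurable_g₂.comp (hs.snd.fst.prodMk ((measurable_const (a := i)).prodMk
      (hqi.prodMk ((measurable_const (a := μ i)).prodMk (measurable_unif 4 hω h4)))))
    have hr := measurable_report μ hs.fst hS
    have hM := P.measurable_g₃.comp (hs.snd.fst.prodMk ((measurable_const (a := i)).prodMk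
      (hqi.prodMk ((measurable_const (a := μ i)).prodMk
        (hr.prodMk (measurable_unif 5 hω h4))))))
    refine measurable_config_iff.2 ⟨ht, hs.fst.prodMk (hM.prodMk hs.snd.snd), h3,
      h4.add_const 1, h5, ?_⟩
    exact h6.add ((measurable_of_countable fun S : Finset (Fin n) => 1 + 2 * S.card).comp hS)

theorem measurable_onDeparture {ω : α → Sample} {t : α → ℝ≥0} {C : α → Config n c} (i : Fin n)
    (hω : Measurable ω) (ht : Measurable t) (hC : Measurable C) :
    Measurable fun a => onDeparture P μ (ω a) i (t a) (C a) := by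
  obtain ⟨h1, h2, h3, h4, h5, h6⟩ := measurable_config_iff.1 hC
  have hs := measurable_flow μ (ht.sub h1) h2
  have hq := measurable_update_index hs.fst (measurable_const (a := i))
    (measurable_tail ((measurable_pi_apply i).comp hs.fst))
  have hqi := (measurable_pi_apply i).comp hq
  have hb := P.measurable_h₁.comp (hqi.prodMk
    ((measurable_const (a := μ i)).prodMk (measurable_unif 6 hω h5)))
  have hM := P.measurable_h₂.comp (hs.snd.fst.prodMk ((measurable_const (a := i)).prodMk
      (hqi.prodMk ((measurable_const (a := μ i)).prodMk (measurable_unif 7 hω h5)))))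
  refine measurable_config_iff.2 ⟨ht, hq.prodMk (Measurable.prodMk ?_ hs.snd.snd), h3, h4,
    h5.add_const 1, h6.add ?_⟩
  · exact Measurable.ite (measurableSet_eq_fun hb measurable_const) hM hs.snd.fst
  · exact Measurable.ite (measurableSet_eq_fun hb measurable_const) measurable_const
      measurable_const

/-- Time of the next service completion at server `i`. -/
noncomputable def completionTime (C : Config n c) (i : Fin n) : ℝ≥0∞ :=
  C.time + completionDelay (μ i) (C.state.1 i)

/-- The next event is an arrival. -/
def ArrivalNext (z : ℝ≥0) (ω : Sample) (C : Config n c) : Prop :=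
  (arrivalTime z ω C.arr : ℝ≥0∞) ≤ messageTime P.β ω C.spon ∧
    ∀ i, (arrivalTime z ω C.arr : ℝ≥0∞) ≤ completionTime μ C i

theorem measurable_completionTime {C : α → Config n c} (hC : Measurable C) (i : Fin n) :
    Measurable fun a => completionTime μ (C a) i := by
  obtain ⟨h1, h2, -⟩ := measurable_config_iff.1 hC
  exact h1.coe_nnreal_ennreal.add
    (measurable_completionDelay (μ i) ((measurable_pi_apply i).comp h2.fst))

theorem measurableSet_arrivalNext (z : ℝ≥0) {ω : α → Sample} {C : α → Config n c}
    (hω : Measurable ω) (hC : Measurable C) :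
    MeasurableSet {a | ArrivalNext P μ z (ω a) (C a)} := by
  have hta := (measurable_arrivalTime z hω (measurable_config_iff.1 hC).2.2.1).coe_nnreal_ennreal
  have hts := measurable_messageTime P.β hω (measurable_config_iff.1 hC).2.2.2.1
  refine (measurableSet_le hta hts).inter
    (?_ : MeasurableSet {a | ∀ i, (arrivalTime z (ω a) (C a).arr : ℝ≥0∞) ≤
      completionTime μ (C a) i})
  rw [Set.ofPred_forall]
  exact MeasurableSet.iInter fun i => measurableSet_le hta (measurable_completionTime μ hC i)

open Classical in
theorem step_eq (z : ℝ≥0) (ω : Sample) (C : Config n c) : step P μ z ω C =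
    if ArrivalNext P μ z ω C then onArrival P μ ω (arrivalTime z ω C.arr) C
    else if ∀ i, messageTime P.β ω C.spon ≤ completionTime μ C i then
      onMessage P μ ω (messageTime P.β ω C.spon).toNNReal C
    else
      match (List.finRange n).find?
        (fun i => decide (∀ j, completionTime μ C i ≤ completionTime μ C j)) with
      | none => C
      | some i => onDeparture P μ ω i (completionTime μ C i).toNNReal C := by
  unfold step ArrivalNext completionTime
  congr!

theorem measurable_step (z : ℝ≥0) {ω : α → Sample} {C : α → Config n c}
    (hω : Measurable ω) (hC : Measurable C) :
    Measurable fun a => step P μ z (ω a) (C a) := by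
  classical
  have hta := measurable_arrivalTime z hω (measurable_config_iff.1 hC).2.2.1
  have hts := measurable_messageTime P.β hω (measurable_config_iff.1 hC).2.2.2.1
  have htd := fun i => measurable_completionTime μ hC i
  simp only [step_eq]
  refine Measurable.ite (measurableSet_arrivalNext P μ z hω hC)
    (measurable_onArrival P μ hω hta hC) (Measurable.ite ?_
      (measurable_onMessage P μ hω hts.ennreal_toNNReal hC) ?_)
  · simp only [Set.ofPred_forall]
    exact MeasurableSet.iInter fun i => measurableSet_le hts (htd i)
  · refine measurable_comp_index (g := fun a => (List.finRange n).find?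
      (fun i => decide (∀ j, completionTime μ (C a) i ≤ completionTime μ (C a) j)))
      (f := fun o a => match o with
      | none => C a
      | some i => onDeparture P μ (ω a) i (completionTime μ (C a) i).toNNReal (C a))
      (fun o => ?_) (measurable_list_find (fun i => ?_) _)
    · cases o with
      | none => exact hC
      | some i => exact measurable_onDeparture P μ i hω (htd i).ennreal_toNNReal hC
    · have hset : MeasurableSet {a | ∀ j, completionTime μ (C a) i ≤ completionTime μ (C a) j} := by
        simp only [Set.ofPred_forall]
        exact MeasurableSet.iInter fun j => measurableSet_le (htd i) (htd j)
      refine measurable_to_bool ?_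
      convert hset using 1
      ext a
      simp

theorem measurable_configAfter (x : State n c) (k : ℕ) :
    Measurable fun ω => configAfter P μ x ω k := by
  induction k with
  | zero => exact measurable_const
  | succ k ih =>
    simp only [configAfter, Function.iterate_succ_apply'] at ih ⊢
    exact measurable_step P μ x.2.2 measurable_id ih

end Measurability

/-! ### Sample path properties -/

section Path

variable {n c : ℕ}

theorem arrivalTime_mono (z : ℝ≥0) (ω : Sample) : Monotone (arrivalTime z ω) := fun _ _ h =>
  tsub_le_tsub_right (Finset.sum_le_sum_of_subset (Finset.range_mono (by omega))) z

theorem messageTime_mono (β : ℝ≥0) (ω : Sample) : Monotone (messageTime β ω) := fun _ _ h =>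
  ENNReal.div_le_div_right (ENNReal.coe_le_coe.2
    (Finset.sum_le_sum_of_subset (Finset.range_mono (by omega)))) _

/-- Service beyond the end of the first job is lost, so only an inequality holds; it is the
direction that bounds completed work by capacity. -/
theorem le_sum_serve_add (x : ℝ≥0) (q : Queue) : q.sum ≤ (serve x q).sum + x := by
  cases q with
  | nil => simp [serve]
  | cons w l =>
    simp only [serve, List.sum_cons]
    calc w + l.sum ≤ (w - x + x) + l.sum := by gcongr; exact le_tsub_add
      _ = _ := by ring

theorem length_serve (x : ℝ≥0) (q : Queue) : (serve x q).length = q.length := by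
  cases q <;> rfl

/-- Remaining workload of the servers in `N`. -/
noncomputable def workloadOn (N : Finset (Fin n)) (s : State n c) : ℝ≥0 := ∑ i ∈ N, (s.1 i).sum

theorem workloadOn_le_flow (N : Finset (Fin n)) (μ : Fin n → ℝ≥0) (d : ℝ≥0) (s : State n c) :
    workloadOn N s ≤ workloadOn N (flow μ d s) + (∑ i ∈ N, μ i) * d := by
  rw [workloadOn, workloadOn, Finset.sum_mul, ← Finset.sum_add_distrib]
  exact Finset.sum_le_sum fun i _ => le_sum_serve_add _ _

variable (P : Policy n c) (μ : Fin n → ℝ≥0)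

theorem step_of_arrivalNext {z : ℝ≥0} {ω : Sample} {C : Config n c}
    (h : ArrivalNext P μ z ω C) :
    step P μ z ω C = onArrival P μ ω (arrivalTime z ω C.arr) C := by
  rw [step_eq, if_pos h]

/-- The bounds by the next arrival time make the event time finite, so that `toNNReal` loses
nothing. -/
theorem step_of_not_arrivalNext {z : ℝ≥0} {ω : Sample} {C : Config n c}
    (h : ¬ ArrivalNext P μ z ω C) :
    (messageTime P.β ω C.spon ≤ arrivalTime z ω C.arr ∧
      step P μ z ω C = onMessage P μ ω (messageTime P.β ω C.spon).toNNReal C) ∨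
    ∃ i, completionTime μ C i ≤ arrivalTime z ω C.arr ∧
      completionTime μ C i ≤ messageTime P.β ω C.spon ∧
      step P μ z ω C = onDeparture P μ ω i (completionTime μ C i).toNNReal C := by
  classical
  rw [step_eq, if_neg h]
  by_cases hm : ∀ i, messageTime P.β ω C.spon ≤ completionTime μ C i
  · left
    rw [if_pos hm]
    refine ⟨?_, rfl⟩
    by_contra! hlt
    exact h ⟨hlt.le, fun i => hlt.le.trans (hm i)⟩
  · right
    rw [if_neg hm]
    push Not at hm
    obtain ⟨i₀, hi₀⟩ := hm
    -- Some completion time is minimal, so the search cannot return `none`.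
    obtain ⟨i₁, -, hi₁⟩ := Finset.exists_min_image Finset.univ (completionTime μ C)
      ⟨i₀, Finset.mem_univ _⟩
    cases hf : (List.finRange n).find?
        (fun i => decide (∀ j, completionTime μ C i ≤ completionTime μ C j)) with
    | none =>
      rw [List.find?_eq_none] at hf
      exact absurd (decide_eq_true fun j => hi₁ j (Finset.mem_univ _))
        (hf i₁ (List.mem_finRange i₁))
    | some i =>
      have hi : ∀ j, completionTime μ C i ≤ completionTime μ C j := by
        have := List.find?_some hf
        simpa using this
      refine ⟨i, ?_, (hi i₀).trans hi₀.le, rfl⟩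
      by_contra! hlt
      exact h ⟨hlt.le.trans ((hi i₀).trans hi₀.le), fun j => hlt.le.trans (hi j)⟩

theorem configAfter_succ (x : State n c) (ω : Sample) (k : ℕ) :
    configAfter P μ x ω (k + 1) = step P μ x.2.2 ω (configAfter P μ x ω k) :=
  Function.iterate_succ_apply' _ _ _

theorem onMessage_fields (ω : Sample) (t : ℝ≥0) (C : Config n c) :
    (onMessage P μ ω t C).time = t ∧ (onMessage P μ ω t C).arr = C.arr ∧
      (onMessage P μ ω t C).spon = C.spon + 1 ∧ (onMessage P μ ω t C).dep = C.dep ∧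
      C.msgs ≤ (onMessage P μ ω t C).msgs ∧
      (onMessage P μ ω t C).state.1 = (flow μ (t - C.time) C.state).1 := by
  unfold onMessage
  dsimp only
  split <;> simp

theorem arr_step (z : ℝ≥0) (ω : Sample) (C : Config n c) (h : ¬ ArrivalNext P μ z ω C) :
    (step P μ z ω C).arr = C.arr := by
  rcases step_of_not_arrivalNext P μ h with ⟨-, h⟩ | ⟨i, -, -, h⟩
  · rw [h]; exact (onMessage_fields P μ ω _ C).2.1
  · rw [h]; rfl

theorem arr_le_arr_step (z : ℝ≥0) (ω : Sample) (C : Config n c) :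
    C.arr ≤ (step P μ z ω C).arr := by
  by_cases h : ArrivalNext P μ z ω C
  · rw [step_of_arrivalNext P μ h]; exact Nat.le_succ _
  · exact (arr_step P μ z ω C h).ge

theorem arr_mono (x : State n c) (ω : Sample) :
    Monotone fun k => (configAfter P μ x ω k).arr :=
  monotone_nat_of_le_succ fun k => by
    rw [configAfter_succ]; exact arr_le_arr_step P μ _ _ _

/-- Number of events before arrival number `j`. -/
noncomputable def preIndex (x : State n c) (ω : Sample) (j : ℕ) : ℕ :=
  sInf {k | (configAfter P μ x ω k).arr = j ∧ ArrivalNext P μ x.2.2 ω (configAfter P μ x ω k)}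

/-- State just before arrival number `j`. -/
noncomputable def preState (x : State n c) (ω : Sample) (j : ℕ) : State n c :=
  flow μ (arrivalTime x.2.2 ω j - (configAfter P μ x ω (preIndex P μ x ω j)).time)
    (configAfter P μ x ω (preIndex P μ x ω j)).state

/-- Servers queried at an arrival that finds the state `s`. -/
def queried (s : State n c) (w : ℝ≥0) (u : unitInterval) : Finset (Fin n) := P.f₁ s.2.1 w u

/-- Destination of a job that finds the state `s`. -/
def destination (s : State n c) (w : ℝ≥0) (u v : unitInterval) : Fin n :=
  P.f₂ s.2.1 w (report s.1 μ (queried P s w u)) v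

/-- Servers queried at arrival number `j`. -/
noncomputable def queriedAt (x : State n c) (ω : Sample) (j : ℕ) : Finset (Fin n) :=
  queried P (preState P μ x ω j) (jobSize ω j) (unif ω 0 j)

/-- Destination of job number `j`. -/
noncomputable def destinationAt (x : State n c) (ω : Sample) (j : ℕ) : Fin n :=
  destination P μ (preState P μ x ω j) (jobSize ω j) (unif ω 0 j) (unif ω 1 j)

/-- An arrival increases the counter `arr`, so the set whose infimum defines `preIndex` has at most
one element. -/
theorem preIndex_arr {x : State n c} {ω : Sample} {k : ℕ}
    (h : ArrivalNext P μ x.2.2 ω (configAfter P μ x ω k)) :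
    preIndex P μ x ω (configAfter P μ x ω k).arr = k := by
  refine le_antisymm (Nat.sInf_le ⟨rfl, h⟩) ?_
  refine le_csInf ⟨k, rfl, h⟩ ?_
  rintro l ⟨hl, hl'⟩
  by_contra! hlk
  have h1 := arr_mono P μ x ω (Nat.succ_le_of_lt hlk)
  simp only [Nat.succ_eq_add_one, configAfter_succ] at h1
  rw [step_of_arrivalNext P μ hl'] at h1
  have h2 : (configAfter P μ x ω l).arr + 1 ≤ (configAfter P μ x ω k).arr := h1
  omega

/-- Properties of the configurations along a sample path. -/
structure PathInv (x : State n c) (ω : Sample) (k : ℕ) (C : Config n c) : Prop where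
  le_arr : C.time ≤ arrivalTime x.2.2 ω C.arr
  le_spon : (C.time : ℝ≥0∞) ≤ messageTime P.β ω C.spon
  arr_le : ∀ j < C.arr, arrivalTime x.2.2 ω j ≤ C.time
  spon_le : ∀ j < C.spon, messageTime P.β ω j ≤ C.time
  jobs : C.dep + ∑ i, (C.state.1 i).length = ∑ i, (x.1 i).length + C.arr
  count : k = C.arr + C.spon + C.dep
  -- Only queries at arrivals are needed; all other messages merely add to the right side.
  msgs_ge : 2 * ∑ j ∈ Finset.range C.arr, (queriedAt P μ x ω j).card ≤ C.msgs
  -- Balance of work: what was sent to `N` is still there or was served at total rate at most `∑ i ∈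
  -- N, μ i`. The initial workload only helps and is dropped.
  work_ge : ∀ N : Finset (Fin n), (∑ j ∈ Finset.range C.arr,
    if destinationAt P μ x ω j ∈ N then jobSize ω j else 0) ≤
      workloadOn N C.state + (∑ i ∈ N, μ i) * C.time

variable {P μ}

theorem onArrival_inv {x : State n c} {ω : Sample} {k : ℕ}
    (hI : PathInv P μ x ω k (configAfter P μ x ω k))
    (h : ArrivalNext P μ x.2.2 ω (configAfter P μ x ω k)) :
    PathInv P μ x ω (k + 1) (onArrival P μ ω
      (arrivalTime x.2.2 ω (configAfter P μ x ω k).arr) (configAfter P μ x ω k)) := by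
  have hpre : preState P μ x ω (configAfter P μ x ω k).arr =
      flow μ (arrivalTime x.2.2 ω (configAfter P μ x ω k).arr - (configAfter P μ x ω k).time)
        (configAfter P μ x ω k).state := by
    rw [preState, preIndex_arr P μ h]
  set C := configAfter P μ x ω k
  set t := arrivalTime x.2.2 ω C.arr with ht
  set s := flow μ (t - C.time) C.state with hs
  have hS : P.f₁ s.2.1 (jobSize ω C.arr) (unif ω 0 C.arr) = queriedAt P μ x ω C.arr := by
    rw [queriedAt, hpre]; rfl
  have hD : P.f₂ s.2.1 (jobSize ω C.arr) (report s.1 μ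
      (P.f₁ s.2.1 (jobSize ω C.arr) (unif ω 0 C.arr))) (unif ω 1 C.arr) =
      destinationAt P μ x ω C.arr := by
    rw [destinationAt, hpre]; rfl
  set D := destinationAt P μ x ω C.arr with hDdef
  have hstate : (onArrival P μ ω t C).state.1 =
      Function.update s.1 D (s.1 D ++ [jobSize ω C.arr]) := by
    rw [← hD]; rfl
  have hmsgs : (onArrival P μ ω t C).msgs = C.msgs + 2 * (queriedAt P μ x ω C.arr).card := by
    rw [← hS]; rfl
  refine ⟨arrivalTime_mono _ _ (Nat.le_succ _), h.1, ?_, ?_, ?_, ?_, ?_, ?_⟩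
  · intro j hj
    exact arrivalTime_mono _ _ (Nat.le_of_lt_succ hj)
  · intro j hj
    exact (hI.spon_le j hj).trans (ENNReal.coe_le_coe.2 hI.le_arr)
  · have hlen : ∑ i, ((onArrival P μ ω t C).state.1 i).length =
        ∑ i, (C.state.1 i).length + 1 := by
      rw [hstate]
      have : ∀ i, (Function.update s.1 D (s.1 D ++ [jobSize ω C.arr]) i).length =
          (C.state.1 i).length + if i = D then 1 else 0 := by
        intro i
        by_cases hi : i = D
        · subst hi
          simp [hs, flow, length_serve]
        · simp [hi, hs, flow, length_serve]
      simp [this, Finset.sum_add_distrib]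
    have := hI.jobs
    change C.dep + ∑ i, ((onArrival P μ ω t C).state.1 i).length = _ + (C.arr + 1)
    omega
  · have := hI.count
    change k + 1 = C.arr + 1 + C.spon + C.dep
    omega
  · change 2 * ∑ j ∈ Finset.range (C.arr + 1), _ ≤ _
    rw [hmsgs, Finset.sum_range_succ]
    have := hI.msgs_ge
    omega
  · intro N
    change ∑ j ∈ Finset.range (C.arr + 1), _ ≤ _ + _ * t
    have hw : workloadOn N (onArrival P μ ω t C).state =
        workloadOn N s + if D ∈ N then jobSize ω C.arr else 0 := by
      rw [workloadOn, hstate]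
      have : ∀ i, (Function.update s.1 D (s.1 D ++ [jobSize ω C.arr]) i).sum =
          (s.1 i).sum + if i = D then jobSize ω C.arr else 0 := by
        intro i
        by_cases hi : i = D
        · subst hi; simp
        · simp [hi]
      simp [this, Finset.sum_add_distrib, workloadOn]
    rw [Finset.sum_range_succ, hw]
    have h1 := hI.work_ge N
    have h2 := workloadOn_le_flow N μ (t - C.time) C.state
    have h3 : C.time + (t - C.time) = t := add_tsub_cancel_of_le hI.le_arr
    calc _ ≤ workloadOn N C.state + (∑ i ∈ N, μ i) * C.time +
          (if D ∈ N then jobSize ω C.arr else 0) := by gcongr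
      _ ≤ workloadOn N s + (∑ i ∈ N, μ i) * (t - C.time) + (∑ i ∈ N, μ i) * C.time +
          (if D ∈ N then jobSize ω C.arr else 0) := by gcongr
      _ = workloadOn N s + (if D ∈ N then jobSize ω C.arr else 0) +
          (∑ i ∈ N, μ i) * (C.time + (t - C.time)) := by ring
      _ = _ := by rw [h3]

theorem onMessage_inv {x : State n c} {ω : Sample} {k : ℕ} {C : Config n c}
    (hI : PathInv P μ x ω k C)
    (h : messageTime P.β ω C.spon ≤ arrivalTime x.2.2 ω C.arr) :
    PathInv P μ x ω (k + 1) (onMessage P μ ω (messageTime P.β ω C.spon).toNNReal C) := by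
  obtain ⟨e1, e2, e3, e4, e5, e6⟩ :=
    onMessage_fields P μ ω (messageTime P.β ω C.spon).toNNReal C
  set t := (messageTime P.β ω C.spon).toNNReal with ht
  have htc : (t : ℝ≥0∞) = messageTime P.β ω C.spon :=
    ENNReal.coe_toNNReal (ne_top_of_le_ne_top ENNReal.coe_ne_top h)
  have hCt : C.time ≤ t := ENNReal.coe_le_coe.1 (htc ▸ hI.le_spon)
  constructor
  · rw [e1, e2]
    exact ENNReal.coe_le_coe.1 (htc ▸ h)
  · rw [e1, e3, htc]
    exact messageTime_mono _ _ (Nat.le_succ _)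
  · rw [e1, e2]
    exact fun j hj => (hI.arr_le j hj).trans hCt
  · rw [e1, e3, htc]
    exact fun j hj => messageTime_mono _ _ (Nat.le_of_lt_succ hj)
  · rw [e2, e4, e6, ← hI.jobs]
    simp [flow, length_serve]
  · rw [e2, e3, e4]
    have := hI.count
    omega
  · rw [e2]
    exact hI.msgs_ge.trans e5
  · intro N
    rw [e1, e2, workloadOn, e6]
    have h1 := hI.work_ge N
    have h2 := workloadOn_le_flow N μ (t - C.time) C.state
    have h3 : C.time + (t - C.time) = t := add_tsub_cancel_of_le hCt
    calc _ ≤ workloadOn N C.state + (∑ i ∈ N, μ i) * C.time := h1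
      _ ≤ workloadOn N (flow μ (t - C.time) C.state) + (∑ i ∈ N, μ i) * (t - C.time) +
          (∑ i ∈ N, μ i) * C.time := by gcongr
      _ = workloadOn N (flow μ (t - C.time) C.state) +
          (∑ i ∈ N, μ i) * (C.time + (t - C.time)) := by ring
      _ = _ := by rw [h3]; rfl

theorem onDeparture_inv {x : State n c} {ω : Sample} {k : ℕ} {C : Config n c} (hμ : ∀ i, 0 < μ i)
    (hI : PathInv P μ x ω k C) {i : Fin n}
    (ha : completionTime μ C i ≤ arrivalTime x.2.2 ω C.arr)
    (hm : completionTime μ C i ≤ messageTime P.β ω C.spon) :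
    PathInv P μ x ω (k + 1) (onDeparture P μ ω i (completionTime μ C i).toNNReal C) := by
  have hne : completionTime μ C i ≠ ⊤ := ne_top_of_le_ne_top ENNReal.coe_ne_top ha
  obtain ⟨w, l, hq⟩ : ∃ w l, C.state.1 i = w :: l := by
    cases hq : C.state.1 i with
    | nil => simp [completionTime, hq, completionDelay] at hne
    | cons w l => exact ⟨w, l, rfl⟩
  have htc' : completionTime μ C i = ((C.time + w / μ i : ℝ≥0) : ℝ≥0∞) := by
    rw [completionTime, hq, completionDelay, ENNReal.coe_add, ENNReal.coe_div (hμ i).ne']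
  set t := (completionTime μ C i).toNNReal with ht
  have htc : (t : ℝ≥0∞) = completionTime μ C i := ENNReal.coe_toNNReal hne
  have hteq : t = C.time + w / μ i := by rw [ht, htc', ENNReal.toNNReal_coe]
  have hCt : C.time ≤ t := by rw [hteq]; exact le_self_add
  set s := flow μ (t - C.time) C.state with hs
  -- As the rate is positive, service up to the completion time exhausts exactly the head job, so
  -- removing it changes no workload.
  have hsi : s.1 i = 0 :: l := by
    have : μ i * (t - C.time) = w := by
      rw [hteq, add_tsub_cancel_left, mul_div_cancel₀ _ (hμ i).ne']
    simp [hs, flow, hq, serve, this]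
  have hstate : (onDeparture P μ ω i t C).state.1 = Function.update s.1 i l := by
    have : (onDeparture P μ ω i t C).state.1 = Function.update s.1 i (s.1 i).tail := rfl
    rw [this, hsi, List.tail_cons]
  constructor
  · exact ENNReal.coe_le_coe.1 (htc ▸ ha)
  · change (t : ℝ≥0∞) ≤ _
    rw [htc]
    exact hm
  · exact fun j hj => (hI.arr_le j hj).trans hCt
  · exact fun j hj => (hI.spon_le j hj).trans (ENNReal.coe_le_coe.2 hCt)
  · have hlen : ∑ j, (C.state.1 j).length =
        ∑ j, ((onDeparture P μ ω i t C).state.1 j).length + 1 := by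
      rw [hstate]
      have : ∀ j, (C.state.1 j).length =
          (Function.update s.1 i l j).length + if j = i then 1 else 0 := by
        intro j
        by_cases hj : j = i
        · subst hj; simp [hq]
        · simp [hj, hs, flow, length_serve]
      simp [this, Finset.sum_add_distrib]
    have := hI.jobs
    change C.dep + 1 + ∑ j, ((onDeparture P μ ω i t C).state.1 j).length = _ + C.arr
    omega
  · have := hI.count
    change k + 1 = C.arr + C.spon + (C.dep + 1)
    omega
  · exact hI.msgs_ge.trans (Nat.le_add_right _ _)
  · intro N
    have hw : workloadOn N (onDeparture P μ ω i t C).state = workloadOn N s := by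
      rw [workloadOn, hstate]
      refine Finset.sum_congr rfl fun j _ => ?_
      by_cases hj : j = i
      · subst hj; simp [hsi]
      · simp [hj]
    rw [hw]
    change _ ≤ _ + _ * t
    have h1 := hI.work_ge N
    have h2 := workloadOn_le_flow N μ (t - C.time) C.state
    have h3 : C.time + (t - C.time) = t := add_tsub_cancel_of_le hCt
    calc _ ≤ workloadOn N C.state + (∑ i ∈ N, μ i) * C.time := h1
      _ ≤ workloadOn N s + (∑ i ∈ N, μ i) * (t - C.time) + (∑ i ∈ N, μ i) * C.time := by gcongr
      _ = workloadOn N s + (∑ i ∈ N, μ i) * (C.time + (t - C.time)) := by ring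
      _ = _ := by rw [h3]

theorem pathInv (hμ : ∀ i, 0 < μ i) (x : State n c) (ω : Sample) (k : ℕ) :
    PathInv P μ x ω k (configAfter P μ x ω k) := by
  induction k with
  | zero =>
    have h0 : configAfter P μ x ω 0 = ⟨0, x, 0, 0, 0, 0⟩ := rfl
    rw [h0]
    constructor <;> simp
  | succ k ih =>
    rw [configAfter_succ]
    by_cases h : ArrivalNext P μ x.2.2 ω (configAfter P μ x ω k)
    · rw [step_of_arrivalNext P μ h]
      exact onArrival_inv ih h
    · rcases step_of_not_arrivalNext P μ h with ⟨h1, h2⟩ | ⟨i, h1, h2, h3⟩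
      · rw [h2]; exact onMessage_inv ih h1
      · rw [h3]; exact onDeparture_inv hμ ih h1 h2

/-- Applied to the last event in `[0, t]`, this places the next arrival after `t`, which bounds the
number of arrivals from below. -/
theorem time_succ_le (x : State n c) (ω : Sample) (k : ℕ) :
    (configAfter P μ x ω (k + 1)).time ≤ arrivalTime x.2.2 ω (configAfter P μ x ω k).arr := by
  rw [configAfter_succ]
  by_cases h : ArrivalNext P μ x.2.2 ω (configAfter P μ x ω k)
  · rw [step_of_arrivalNext P μ h]; exact le_rfl
  · rcases step_of_not_arrivalNext P μ h with ⟨h1, h2⟩ | ⟨i, h1, h2, h3⟩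
    · rw [h2, (onMessage_fields P μ ω _ _).1]
      exact ENNReal.toNNReal_mono ENNReal.coe_ne_top h1
    · rw [h3]
      exact ENNReal.toNNReal_mono ENNReal.coe_ne_top h1

/-! ### Non-explosion and the situation at a fixed time. -/

/-- Arrivals and spontaneous messages do not accumulate. -/
structure NonExplosive (β z : ℝ≥0) (ω : Sample) : Prop where
  arrival : ∀ t : ℝ≥0, ∃ k, t < arrivalTime z ω k
  message : ∀ t : ℝ≥0, ∃ k, (t : ℝ≥0∞) < messageTime β ω k

/-- Departures are bounded by the initial jobs plus the arrivals, so they cannot accumulate on their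
own. Boundedness makes the `sSup` in `eventCount` a maximum rather than a default value. -/
theorem bddAbove_events (hμ : ∀ i, 0 < μ i) {x : State n c} {ω : Sample}
    (hω : NonExplosive P.β x.2.2 ω) (t : ℝ≥0) :
    BddAbove {k : ℕ | (configAfter P μ x ω k).time ≤ t} := by
  obtain ⟨K₁, hK₁⟩ := hω.arrival t
  obtain ⟨K₂, hK₂⟩ := hω.message t
  refine ⟨2 * K₁ + K₂ + ∑ i, (x.1 i).length, fun k hk => ?_⟩
  have hk : (configAfter P μ x ω k).time ≤ t := hk
  have hI := pathInv (P := P) hμ x ω k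
  have h1 : (configAfter P μ x ω k).arr ≤ K₁ := by
    by_contra! h
    exact absurd ((hI.arr_le K₁ h).trans hk) (not_le.2 hK₁)
  have h2 : (configAfter P μ x ω k).spon ≤ K₂ := by
    by_contra! h
    exact absurd ((hI.spon_le K₂ h).trans (ENNReal.coe_le_coe.2 hk)) (not_le.2 hK₂)
  have h3 := hI.jobs
  have h4 := hI.count
  omega

theorem configAt_spec (hμ : ∀ i, 0 < μ i) {x : State n c} {ω : Sample}
    (hω : NonExplosive P.β x.2.2 ω) (t : ℝ≥0) :
    t < arrivalTime x.2.2 ω (configAt P μ x t ω).arr ∧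
    2 * ∑ j ∈ Finset.range (configAt P μ x t ω).arr, (queriedAt P μ x ω j).card ≤
      (configAt P μ x t ω).msgs ∧
    ∀ N : Finset (Fin n), (∑ j ∈ Finset.range (configAt P μ x t ω).arr,
      if destinationAt P μ x ω j ∈ N then jobSize ω j else 0) ≤
        totalWorkload P μ x t ω + (∑ i ∈ N, μ i) * t := by
  have hbdd := bddAbove_events hμ hω t
  have hmem : eventCount P μ x t ω ∈ {k : ℕ | (configAfter P μ x ω k).time ≤ t} :=
    Nat.sSup_mem ⟨0, show (0 : ℝ≥0) ≤ t from zero_le⟩ hbdd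
  have hle : (configAt P μ x t ω).time ≤ t := hmem
  have hI := pathInv (P := P) hμ x ω (eventCount P μ x t ω)
  change PathInv P μ x ω _ (configAt P μ x t ω) at hI
  refine ⟨?_, hI.msgs_ge, fun N => ?_⟩
  · refine lt_of_lt_of_le ?_ (time_succ_le x ω (eventCount P μ x t ω))
    by_contra! h
    exact absurd (le_csSup hbdd h) (Nat.not_succ_le_self _)
  · set C := configAt P μ x t ω
    have h1 := hI.work_ge N
    have h2 := workloadOn_le_flow N μ (t - C.time) C.state
    have h3 : C.time + (t - C.time) = t := add_tsub_cancel_of_le hle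
    have h4 : workloadOn N (flow μ (t - C.time) C.state) ≤ totalWorkload P μ x t ω :=
      Finset.sum_le_sum_of_subset (f := fun i => ((process P μ x t ω).1 i).sum)
        (Finset.subset_univ N)
    calc _ ≤ workloadOn N C.state + (∑ i ∈ N, μ i) * C.time := h1
      _ ≤ workloadOn N (flow μ (t - C.time) C.state) + (∑ i ∈ N, μ i) * (t - C.time) +
          (∑ i ∈ N, μ i) * C.time := by gcongr
      _ = workloadOn N (flow μ (t - C.time) C.state) +
          (∑ i ∈ N, μ i) * (C.time + (t - C.time)) := by ring
      _ ≤ _ := by rw [h3]; gcongr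

end Path

/-! ### Resampling -/

section Resampling

theorem measurePreserving_assoc {X Y Z : Type*} [MeasurableSpace X] [MeasurableSpace Y]
    [MeasurableSpace Z] (μ : Measure X) (ν : Measure Y) (ρ : Measure Z) [SFinite μ] [SFinite ν]
    [SFinite ρ] : MeasurePreserving (MeasurableEquiv.prodAssoc : (X × Y) × Z ≃ᵐ X × Y × Z)
      ((μ.prod ν).prod ρ) (μ.prod (ν.prod ρ)) :=
  ⟨MeasurableEquiv.prodAssoc.measurable, Measure.prodAssoc_prod⟩

theorem measurePreserving_resample_snd {X Y Z : Type*} [MeasurableSpace X] [MeasurableSpace Y]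
    [MeasurableSpace Z] {μ : Measure X} {ν : Measure Y} {ρ : Measure Z} [SFinite μ] [SFinite ν]
    [SFinite ρ] {ψ : Y × Z → Y} (h : MeasurePreserving ψ (ν.prod ρ) ν) :
    MeasurePreserving (fun p : (X × Y) × Z => (p.1.1, ψ (p.1.2, p.2))) ((μ.prod ν).prod ρ)
      (μ.prod ν) :=
  ((MeasurePreserving.id μ).prod h).comp (measurePreserving_assoc μ ν ρ)

theorem measurePreserving_resample_fst {X Y Z : Type*} [MeasurableSpace X] [MeasurableSpace Y]
    [MeasurableSpace Z] {μ : Measure X} {ν : Measure Y} {ρ : Measure Z} [SFinite μ] [SFinite ν]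
    [SFinite ρ] {ψ : X × Z → X} (h : MeasurePreserving ψ (μ.prod ρ) μ) :
    MeasurePreserving (fun p : (X × Y) × Z => (ψ (p.1.1, p.2), p.1.2)) ((μ.prod ν).prod ρ)
      (μ.prod ν) := by
  have hswap : MeasurePreserving (Prod.swap : X × Y → Y × X) (μ.prod ν) (ν.prod μ) :=
    Measure.measurePreserving_swap
  have hswap' : MeasurePreserving (Prod.swap : Y × X → X × Y) (ν.prod μ) (μ.prod ν) :=
    Measure.measurePreserving_swap
  exact hswap'.comp ((measurePreserving_resample_snd h).comp
    (hswap.prod (MeasurePreserving.id ρ)))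

theorem measurePreserving_resample_comp {Y Z Z' : Type*} [MeasurableSpace Y] [MeasurableSpace Z]
    [MeasurableSpace Z'] {ν : Measure Y} {ρ : Measure Z} {ρ' : Measure Z'} [SFinite ν]
    [SFinite ρ] [SFinite ρ'] {ψ : Y × Z → Y} {ψ' : Y × Z' → Y}
    (h : MeasurePreserving ψ (ν.prod ρ) ν) (h' : MeasurePreserving ψ' (ν.prod ρ') ν) :
    MeasurePreserving (fun p : Y × Z × Z' => ψ' (ψ (p.1, p.2.1), p.2.2)) (ν.prod (ρ.prod ρ')) ν :=
  h'.comp ((h.prod (MeasurePreserving.id ρ')).comp (measurePreserving_assoc ν ρ ρ').symm)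

/-- On boxes only the factor `i` changes, and it averages to `μ (t i)`. The map `φ` is general so
that the lemma can be nested: changing one randomization variable is an update inside one of the
eight sequences. -/
theorem measurePreserving_update_infinitePi {ι X Z : Type*} [DecidableEq ι] [MeasurableSpace X]
    [MeasurableSpace Z] {μ : Measure X} [IsProbabilityMeasure μ] {ρ : Measure Z}
    [IsProbabilityMeasure ρ] {φ : X × Z → X} (h : MeasurePreserving φ (μ.prod ρ) μ) (i : ι) :
    MeasurePreserving (fun p : (ι → X) × Z => Function.update p.1 i (φ (p.1 i, p.2)))
      ((Measure.infinitePi fun _ : ι => μ).prod ρ) (Measure.infinitePi fun _ : ι => μ) := by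
  have hm : Measurable (fun p : (ι → X) × Z => Function.update p.1 i (φ (p.1 i, p.2))) := by
    refine measurable_pi_lambda _ fun k => ?_
    by_cases hk : k = i
    · subst hk
      simp only [Function.update_self]
      exact h.measurable.comp (((measurable_pi_apply k).comp measurable_fst).prodMk measurable_snd)
    · simp only [Function.update_of_ne hk]
      exact (measurable_pi_apply k).comp measurable_fst
  refine ⟨hm, Measure.eq_infinitePi _ fun s t ht => ?_⟩
  have hbox : MeasurableSet (Set.pi (s : Set ι) t) :=
    MeasurableSet.pi s.countable_toSet fun k _ => ht k
  rw [Measure.map_apply hm hbox, Measure.prod_apply_symm (hm hbox)]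
  have hsec : ∀ z : Z, MeasurableSet {x | φ (x, z) ∈ t i} := fun z =>
    (h.measurable.comp measurable_prodMk_right) (ht i)
  have hpre : ∀ z : Z, (fun ω : ι → X => (ω, z)) ⁻¹'
      ((fun p : (ι → X) × Z => Function.update p.1 i (φ (p.1 i, p.2))) ⁻¹' Set.pi (s : Set ι) t) =
      Set.pi (s : Set ι) (Function.update t i {x | φ (x, z) ∈ t i}) := by
    intro z
    ext ω
    simp only [Set.mem_preimage, Set.mem_pi]
    refine forall₂_congr fun k _ => ?_
    by_cases hk : k = i
    · subst hk; simp
    · simp [hk]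
  have hval : ∀ z : Z, (Measure.infinitePi fun _ : ι => μ)
      (Set.pi (s : Set ι) (Function.update t i {x | φ (x, z) ∈ t i})) =
      ∏ k ∈ s, μ (Function.update t i {x | φ (x, z) ∈ t i} k) := fun z =>
    Measure.infinitePi_pi _ fun k _ => by
      by_cases hk : k = i
      · subst hk; simpa using hsec z
      · simpa [hk] using ht k
  simp only [hpre, hval]
  by_cases hi : i ∈ s
  · have hprod : ∀ A : Set X, ∏ k ∈ s, μ (Function.update t i A k) =
        μ A * ∏ k ∈ s.erase i, μ (t k) := by
      intro A
      rw [← Finset.mul_prod_erase s _ hi, Function.update_self]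
      congr 1
      refine Finset.prod_congr rfl fun k hk => ?_
      rw [Function.update_of_ne (Finset.ne_of_mem_erase hk)]
    have hint : ∫⁻ z, μ {x | φ (x, z) ∈ t i} ∂ρ = μ (t i) := by
      rw [← h.measure_preimage (ht i).nullMeasurableSet,
        Measure.prod_apply_symm (h.measurable (ht i))]
      rfl
    simp only [hprod]
    rw [lintegral_mul_const', hint, Finset.mul_prod_erase s (fun k => μ (t k)) hi]
    exact (ENNReal.prod_lt_top fun k _ => measure_lt_top _ _).ne
  · have hprod : ∀ A : Set X, ∏ k ∈ s, μ (Function.update t i A k) = ∏ k ∈ s, μ (t k) := by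
      intro A
      refine Finset.prod_congr rfl fun k hk => ?_
      rw [Function.update_of_ne (ne_of_mem_of_not_mem hk hi)]
    simp [hprod]

theorem measurePreserving_update_eval {X : Type*} [MeasurableSpace X] (μ : Measure X)
    [IsProbabilityMeasure μ] (j : ℕ) :
    MeasurePreserving (fun p : (ℕ → X) × X => Function.update p.1 j p.2)
      ((Measure.infinitePi fun _ : ℕ => μ).prod μ) (Measure.infinitePi fun _ : ℕ => μ) :=
  measurePreserving_update_infinitePi (φ := Prod.snd) (μ := μ) (ρ := μ)
    measurePreserving_snd j

/-- Replace the size of job `j`. -/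
def setSize (j : ℕ) (p : Sample × ℝ≥0) : Sample :=
  (p.1.1, p.1.2.1, Function.update p.1.2.2.1 j p.2, p.1.2.2.2)

/-- Replace the randomization variable number `j` of kind `i`. -/
def setUnif (i : Fin 8) (j : ℕ) (p : Sample × unitInterval) : Sample :=
  (p.1.1, p.1.2.1, p.1.2.2.1,
    Function.update p.1.2.2.2 i (Function.update (p.1.2.2.2 i) j p.2))

/-- Replace the size of job `j` and the variables used for its routing. -/
def resample (j : ℕ) (p : Sample × ℝ≥0 × unitInterval × unitInterval) : Sample :=
  setUnif 1 j (setUnif 0 j (setSize j (p.1, p.2.1), p.2.2.1), p.2.2.2)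

instance isProbabilityMeasure_unitExp : IsProbabilityMeasure unitExp := by
  have : IsProbabilityMeasure (expMeasure 1) := isProbabilityMeasure_expMeasure one_pos
  exact Measure.isProbabilityMeasure_map measurable_real_toNNReal.aemeasurable

variable (G F : Measure ℝ≥0) [IsProbabilityMeasure G] [IsProbabilityMeasure F]

instance isProbabilityMeasure_baseLaw : IsProbabilityMeasure (baseLaw G F) := by
  unfold baseLaw; infer_instance

theorem measurePreserving_setSize (j : ℕ) :
    MeasurePreserving (setSize j) ((baseLaw G F).prod F) (baseLaw G F) :=
  measurePreserving_resample_snd (measurePreserving_resample_snd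
    (measurePreserving_resample_fst (measurePreserving_update_eval F j)))

theorem measurePreserving_setUnif (i : Fin 8) (j : ℕ) :
    MeasurePreserving (setUnif i j) ((baseLaw G F).prod volume) (baseLaw G F) := by
  have h := measurePreserving_update_infinitePi
    (measurePreserving_update_eval (volume : Measure unitInterval) j) i
  rw [Measure.infinitePi_eq_pi] at h
  exact measurePreserving_resample_snd (measurePreserving_resample_snd
    (measurePreserving_resample_snd h))

theorem measurePreserving_resample (j : ℕ) :
    MeasurePreserving (resample j) ((baseLaw G F).prod (F.prod (volume.prod volume)))
      (baseLaw G F) := by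
  have h := measurePreserving_resample_comp (measurePreserving_setSize G F j)
    (measurePreserving_resample_comp (measurePreserving_setUnif G F 0 j)
      (measurePreserving_setUnif G F 1 j))
  exact h

/-! ### Dependence of the sample path on the data of one job. -/

/-- Two samples differ at most in the size of job `j` and the variables used for its routing. -/
structure AgreeOff (j : ℕ) (ω ω' : Sample) : Prop where
  arrival : ω.1 = ω'.1
  message : ω.2.1 = ω'.2.1
  size : ∀ k ≠ j, jobSize ω k = jobSize ω' k
  unif_eq : ∀ i k, (k ≠ j ∨ (i ≠ 0 ∧ i ≠ 1)) → unif ω i k = unif ω' i k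

theorem AgreeOff.symm {j : ℕ} {ω ω' : Sample} (h : AgreeOff j ω ω') : AgreeOff j ω' ω :=
  ⟨h.arrival.symm, h.message.symm, fun k hk => (h.size k hk).symm,
    fun i k hk => (h.unif_eq i k hk).symm⟩

theorem agreeOff_resample (j : ℕ) (p : Sample × ℝ≥0 × unitInterval × unitInterval) :
    AgreeOff j p.1 (resample j p) := by
  refine ⟨rfl, rfl, fun k hk => ?_, fun i k hk => ?_⟩
  · simp [jobSize, resample, setSize, setUnif, hk]
  · simp only [unif, resample, setSize, setUnif]
    by_cases h1 : i = 1
    · subst h1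
      have hk' : k ≠ j := by tauto
      simp [hk']
    · by_cases h0 : i = 0
      · subst h0
        have hk' : k ≠ j := by tauto
        simp [hk']
      · simp [h0, h1]

theorem resample_apply (j : ℕ) (p : Sample × ℝ≥0 × unitInterval × unitInterval) :
    jobSize (resample j p) j = p.2.1 ∧ unif (resample j p) 0 j = p.2.2.1 ∧
      unif (resample j p) 1 j = p.2.2.2 := by
  refine ⟨?_, ?_, ?_⟩ <;> simp [jobSize, unif, resample, setSize, setUnif]

variable {n c : ℕ} {P : Policy n c} {μ : Fin n → ℝ≥0} {j : ℕ} {ω ω' : Sample}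

theorem AgreeOff.arrivalTime_eq (h : AgreeOff j ω ω') (z : ℝ≥0) :
    arrivalTime z ω = arrivalTime z ω' := by
  funext k; simp only [arrivalTime, h.arrival]

theorem AgreeOff.messageTime_eq (h : AgreeOff j ω ω') (β : ℝ≥0) :
    messageTime β ω = messageTime β ω' := by
  funext k; simp only [messageTime, h.message]

theorem AgreeOff.arrivalNext_iff (h : AgreeOff j ω ω') (z : ℝ≥0) (C : Config n c) :
    ArrivalNext P μ z ω C ↔ ArrivalNext P μ z ω' C := by
  rw [ArrivalNext, ArrivalNext, h.arrivalTime_eq, h.messageTime_eq]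

/-- The data in which the samples may differ are read only at arrival `j`; messages and departures
use other kinds of randomization variables. -/
theorem AgreeOff.step_eq_step (h : AgreeOff j ω ω') {z : ℝ≥0} {C : Config n c}
    (hC : ¬ (ArrivalNext P μ z ω C ∧ C.arr = j)) : step P μ z ω' C = step P μ z ω C := by
  classical
  have hdep : ∀ i t, onDeparture P μ ω' i t C = onDeparture P μ ω i t C := by
    intro i t
    simp only [onDeparture, h.unif_eq 6 C.dep (Or.inr (by decide)),
      h.unif_eq 7 C.dep (Or.inr (by decide))]
  have hmsg : ∀ t, onMessage P μ ω' t C = onMessage P μ ω t C := by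
    intro t
    simp only [onMessage, h.unif_eq 3 C.spon (Or.inr (by decide)),
      h.unif_eq 4 C.spon (Or.inr (by decide)), h.unif_eq 5 C.spon (Or.inr (by decide))]
  rw [step_eq, step_eq]
  by_cases ha : ArrivalNext P μ z ω C
  · have hj : C.arr ≠ j := fun e => hC ⟨ha, e⟩
    rw [if_pos ha, if_pos ((h.arrivalNext_iff z C).1 ha)]
    simp only [onArrival, h.arrivalTime_eq, h.size _ hj, h.unif_eq _ _ (Or.inl hj)]
  · rw [if_neg ha, if_neg fun hb => ha ((h.arrivalNext_iff z C).2 hb)]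
    simp only [h.messageTime_eq, hmsg, hdep]

theorem AgreeOff.configAfter_eq (h : AgreeOff j ω ω') (x : State n c) {k : ℕ}
    (hk : (configAfter P μ x ω k).arr ≤ j) :
    configAfter P μ x ω' k = configAfter P μ x ω k := by
  induction k with
  | zero => rfl
  | succ k ih =>
    have hk' := (arr_mono P μ x ω (Nat.le_succ k)).trans hk
    rw [configAfter_succ, configAfter_succ, ih hk']
    refine h.step_eq_step ?_
    rintro ⟨ha, hj⟩
    rw [configAfter_succ, step_of_arrivalNext P μ ha] at hk
    have : (configAfter P μ x ω k).arr + 1 ≤ j := hk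
    omega

/-- The state found by job `j` is settled before its size and routing variables are read. This
nonanticipation takes the place of a filtration. -/
theorem AgreeOff.preState_eq (h : AgreeOff j ω ω') (x : State n c) {i : ℕ} (hi : i ≤ j) :
    preState P μ x ω' i = preState P μ x ω i := by
  have hset : {k | (configAfter P μ x ω' k).arr = i ∧
      ArrivalNext P μ x.2.2 ω' (configAfter P μ x ω' k)} = {k | (configAfter P μ x ω k).arr = i ∧
      ArrivalNext P μ x.2.2 ω (configAfter P μ x ω k)} := by
    ext k
    constructor
    · rintro ⟨h1, h2⟩
      have h3 := h.symm.configAfter_eq (P := P) (μ := μ) x (h1.trans_le hi)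
      exact ⟨by rw [h3]; exact h1, by rw [h3]; exact (h.arrivalNext_iff _ _).2 h2⟩
    · rintro ⟨h1, h2⟩
      have h3 := h.configAfter_eq (P := P) (μ := μ) x (h1.trans_le hi)
      exact ⟨by rw [h3]; exact h1, by rw [h3]; exact (h.arrivalNext_iff _ _).1 h2⟩
  have hidx : preIndex P μ x ω' i = preIndex P μ x ω i := by
    rw [preIndex, hset]; rfl
  have hconf : configAfter P μ x ω' (preIndex P μ x ω i) =
      configAfter P μ x ω (preIndex P μ x ω i) := by
    -- If arrival `i` never occurs, `preIndex` has the default value `0`, where both paths are at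
    -- the initial state.
    rcases Set.eq_empty_or_nonempty {k | (configAfter P μ x ω k).arr = i ∧
      ArrivalNext P μ x.2.2 ω (configAfter P μ x ω k)} with he | hne
    · have : preIndex P μ x ω i = 0 := by rw [preIndex, he, Nat.sInf_empty]
      rw [this]; rfl
    · exact h.configAfter_eq x ((Nat.sInf_mem hne).1.trans_le hi)
  rw [preState, preState, hidx, hconf, h.arrivalTime_eq]

theorem measurable_preState (P : Policy n c) (μ : Fin n → ℝ≥0) (x : State n c) (j : ℕ) :
    Measurable fun ω => preState P μ x ω j := by
  have hC := measurable_configAfter P μ x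
  have hA : ∀ k, MeasurableSet {ω | (configAfter P μ x ω k).arr = j ∧
      ArrivalNext P μ x.2.2 ω (configAfter P μ x ω k)} := fun k =>
    (measurableSet_eq_fun (measurable_config_iff.1 (hC k)).2.2.1 measurable_const).inter
      (measurableSet_arrivalNext P μ x.2.2 measurable_id (hC k))
  have hidx : Measurable fun ω => preIndex P μ x ω j := by
    refine measurable_of_Iic fun l => ?_
    -- The second set collects the samples without such an event, where `sInf ∅ = 0 ≤ l`.
    have : (fun ω => preIndex P μ x ω j) ⁻¹' Set.Iic l =
        (⋃ k ∈ Set.Iic l, {ω | (configAfter P μ x ω k).arr = j ∧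
          ArrivalNext P μ x.2.2 ω (configAfter P μ x ω k)}) ∪
        ⋂ k, {ω | (configAfter P μ x ω k).arr = j ∧
          ArrivalNext P μ x.2.2 ω (configAfter P μ x ω k)}ᶜ := by
      ext ω
      simp only [Set.mem_preimage, Set.mem_Iic, Set.mem_union, Set.mem_iUnion, Set.mem_iInter,
        exists_prop]
      constructor
      · intro hl
        rcases Set.eq_empty_or_nonempty {k | (configAfter P μ x ω k).arr = j ∧
          ArrivalNext P μ x.2.2 ω (configAfter P μ x ω k)} with he | hne
        · right
          intro k hk
          have : k ∈ (∅ : Set ℕ) := he ▸ hk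
          exact this
        · exact Or.inl ⟨_, hl, Nat.sInf_mem hne⟩
      · rintro (⟨k, hk, hk'⟩ | hall)
        · exact (Nat.sInf_le hk').trans hk
        · have : {k | (configAfter P μ x ω k).arr = j ∧
              ArrivalNext P μ x.2.2 ω (configAfter P μ x ω k)} = ∅ :=
            Set.eq_empty_of_forall_notMem fun k hk => hall k hk
          rw [preIndex, this, Nat.sInf_empty]
          exact Nat.zero_le _
    rw [this]
    exact (MeasurableSet.biUnion (Set.to_countable _) fun k _ => hA k).union
      (MeasurableSet.iInter fun k => (hA k).compl)
  refine measurable_comp_index (f := fun k ω =>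
    flow μ (arrivalTime x.2.2 ω j - (configAfter P μ x ω k).time) (configAfter P μ x ω k).state)
    (fun k => ?_) hidx
  obtain ⟨h1, h2, -⟩ := measurable_config_iff.1 (hC k)
  exact measurable_flow μ ((measurable_arrivalTime x.2.2 measurable_id measurable_const).sub h1) h2

end Resampling

/-! ### A law of large numbers -/

theorem exp_neg_le_quadratic {θ y B : ℝ} (hθ : 0 ≤ θ) (hθB : θ * B ≤ 1) (hy : |y| ≤ B) :
    Real.exp (-θ * y) ≤ 1 - θ * y + θ ^ 2 * B ^ 2 := by
  have h1 : |-θ * y| ≤ 1 := by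
    rw [abs_mul, abs_neg, abs_of_nonneg hθ]
    exact (mul_le_mul_of_nonneg_left hy hθ).trans hθB
  have h2 := (abs_le.1 (Real.abs_exp_sub_one_sub_id_le h1)).2
  have h3 : y ^ 2 ≤ B ^ 2 := sq_le_sq' (abs_le.1 hy).1 (abs_le.1 hy).2
  nlinarith [mul_le_mul_of_nonneg_left h3 (sq_nonneg θ)]

/-- Bounded increments with nonnegative mean given the past, where conditioning on the past is
expressed by resampling. -/
theorem ae_eventually_le_sum {Ω Ξ : Type*} [MeasurableSpace Ω] [MeasurableSpace Ξ] {Pr : Measure Ω}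
    [IsProbabilityMeasure Pr] {ρ : Measure Ξ} [IsProbabilityMeasure ρ] {R : ℕ → Ω × Ξ → Ω}
    (hR : ∀ j, MeasurePreserving (R j) (Pr.prod ρ) Pr) {Y : ℕ → Ω → ℝ}
    (hY : ∀ j, Measurable (Y j)) {B : ℝ} (hB : ∀ j ω, |Y j ω| ≤ B)
    (hpast : ∀ i j, i < j → ∀ p, Y i (R j p) = Y i p.1)
    (hmean : ∀ j ω, 0 ≤ ∫ ξ, Y j (R j (ω, ξ)) ∂ρ) {δ : ℝ} (hδ : 0 < δ) :
    ∀ᵐ ω ∂Pr, ∀ᶠ K : ℕ in atTop, -(δ * K) ≤ ∑ j ∈ Finset.range K, Y j ω := by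
  have hB0 : 0 ≤ B := by
    obtain ⟨ω⟩ := nonempty_of_isProbabilityMeasure Pr
    exact (abs_nonneg _).trans (hB 0 ω)
  -- The first condition permits the quadratic bound on the exponential; the second keeps the
  -- quadratic term below half of the gain `θ * δ`.
  obtain ⟨θ, hθ0, hθB, hθδ⟩ : ∃ θ : ℝ, 0 < θ ∧ θ * B ≤ 1 ∧ θ * B ^ 2 ≤ δ / 2 := by
    refine ⟨min (1 / (B + 1)) (δ / 2 / (B ^ 2 + 1)), by positivity, ?_, ?_⟩
    · calc _ ≤ 1 / (B + 1) * B := mul_le_mul_of_nonneg_right (min_le_left _ _) hB0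
        _ ≤ 1 := by rw [one_div_mul_eq_div, div_le_one (by positivity)]; linarith
    · calc _ ≤ δ / 2 / (B ^ 2 + 1) * B ^ 2 :=
            mul_le_mul_of_nonneg_right (min_le_right _ _) (by positivity)
        _ ≤ δ / 2 := by
          rw [div_mul_eq_mul_div, div_le_iff₀ (by positivity)]
          nlinarith
  set S : ℕ → Ω → ℝ := fun K ω => ∑ j ∈ Finset.range K, Y j ω with hS
  have hSm : ∀ K, Measurable (S K) := fun K => Finset.measurable_sum _ fun j _ => hY j
  have hSB : ∀ K ω, |S K ω| ≤ K * B := by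
    intro K ω
    calc |S K ω| ≤ ∑ j ∈ Finset.range K, |Y j ω| := Finset.abs_sum_le_sum_abs _ _
      _ ≤ ∑ j ∈ Finset.range K, B := Finset.sum_le_sum fun j _ => hB j ω
      _ = K * B := by simp
  have hbound : ∀ K ω, ‖Real.exp (-θ * S K ω)‖ ≤ Real.exp (θ * (K * B)) := by
    intro K ω
    rw [Real.norm_eq_abs, Real.abs_exp]
    refine Real.exp_le_exp.2 ?_
    nlinarith [neg_abs_le (S K ω), hSB K ω]
  have hexpm : ∀ K, Measurable fun ω => Real.exp (-θ * S K ω) := fun K =>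
    Real.measurable_exp.comp ((hSm K).const_mul _)
  have hint : ∀ K, Integrable (fun ω => Real.exp (-θ * S K ω)) Pr := fun K =>
    Integrable.of_bound (hexpm K).aestronglyMeasurable _ (Eventually.of_forall (hbound K))
  -- `R K` carries `Pr.prod ρ` to `Pr` and leaves the first `K` increments unchanged, so the
  -- exponential factorizes and the integral over `ρ` acts as a conditional expectation.
  have hstep : ∀ K, ∫ ω, Real.exp (-θ * S (K + 1) ω) ∂Pr ≤
      (1 + θ ^ 2 * B ^ 2) * ∫ ω, Real.exp (-θ * S K ω) ∂Pr := by
    intro K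
    have hYR : ∀ ω, Measurable fun ξ => Y K (R K (ω, ξ)) := fun ω =>
      ((hY K).comp (hR K).measurable).comp measurable_prodMk_left
    have hfac : ∀ ω ξ, Real.exp (-θ * S (K + 1) (R K (ω, ξ))) =
        Real.exp (-θ * S K ω) * Real.exp (-θ * Y K (R K (ω, ξ))) := by
      intro ω ξ
      have : S (K + 1) (R K (ω, ξ)) = S K ω + Y K (R K (ω, ξ)) := by
        simp only [hS, Finset.sum_range_succ]
        congr 1
        exact Finset.sum_congr rfl fun i hi => hpast i K (Finset.mem_range.1 hi) _
      rw [this, mul_add, Real.exp_add]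
    have hinner : ∀ ω, ∫ ξ, Real.exp (-θ * Y K (R K (ω, ξ))) ∂ρ ≤ 1 + θ ^ 2 * B ^ 2 := by
      intro ω
      have hYi : Integrable (fun ξ => Y K (R K (ω, ξ))) ρ :=
        Integrable.of_bound (hYR ω).aestronglyMeasurable B
          (Eventually.of_forall fun ξ => hB K _)
      calc ∫ ξ, Real.exp (-θ * Y K (R K (ω, ξ))) ∂ρ
          ≤ ∫ ξ, ((1 + θ ^ 2 * B ^ 2) - θ * Y K (R K (ω, ξ))) ∂ρ := by
            refine integral_mono_of_nonneg (Eventually.of_forall fun ξ => (Real.exp_pos _).le)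
              ((integrable_const _).sub (hYi.const_mul θ)) (Eventually.of_forall fun ξ => ?_)
            have := exp_neg_le_quadratic hθ0.le hθB (hB K (R K (ω, ξ)))
            simp only
            linarith
        _ = (1 + θ ^ 2 * B ^ 2) - θ * ∫ ξ, Y K (R K (ω, ξ)) ∂ρ := by
            rw [integral_sub (integrable_const _) (hYi.const_mul θ), integral_const_mul]
            simp
        _ ≤ _ := by nlinarith [hmean K ω]
    have hRi : Integrable (fun p => Real.exp (-θ * S (K + 1) (R K p))) (Pr.prod ρ) :=
      Integrable.of_bound ((hexpm (K + 1)).comp (hR K).measurable).aestronglyMeasurable _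
        (Eventually.of_forall fun p => hbound (K + 1) (R K p))
    calc ∫ ω, Real.exp (-θ * S (K + 1) ω) ∂Pr
        = ∫ p, Real.exp (-θ * S (K + 1) (R K p)) ∂(Pr.prod ρ) := by
          conv_lhs => rw [← (hR K).map_eq]
          rw [integral_map (hR K).measurable.aemeasurable (hexpm (K + 1)).aestronglyMeasurable]
      _ = ∫ ω, Real.exp (-θ * S K ω) * ∫ ξ, Real.exp (-θ * Y K (R K (ω, ξ))) ∂ρ ∂Pr := by
          rw [integral_prod _ hRi]
          refine integral_congr_ae (Eventually.of_forall fun ω => ?_)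
          simp only [hfac, integral_const_mul]
      _ ≤ ∫ ω, Real.exp (-θ * S K ω) * (1 + θ ^ 2 * B ^ 2) ∂Pr := by
          refine integral_mono_of_nonneg (Eventually.of_forall fun ω => ?_)
            ((hint K).mul_const _) (Eventually.of_forall fun ω => ?_)
          · exact mul_nonneg (Real.exp_pos _).le (integral_nonneg fun ξ => (Real.exp_pos _).le)
          · exact mul_le_mul_of_nonneg_left (hinner ω) (Real.exp_pos _).le
      _ = _ := by rw [integral_mul_const, mul_comm]
  have hM : ∀ K, ∫ ω, Real.exp (-θ * S K ω) ∂Pr ≤ (1 + θ ^ 2 * B ^ 2) ^ K := by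
    intro K
    induction K with
    | zero => simp [hS]
    | succ K ih =>
      rw [pow_succ']
      exact (hstep K).trans (mul_le_mul_of_nonneg_left ih (by positivity))
  -- A Chernoff bound with geometric decay, summed below for the Borel–Cantelli lemma.
  have hprob : ∀ K : ℕ, Pr {ω | S K ω ≤ -(δ * K)} ≤
      ENNReal.ofReal (Real.exp (-(θ * δ / 2)) ^ K) := by
    intro K
    have h1 := measure_le_le_exp_mul_mgf (μ := Pr) (X := S K) (t := -θ) (-(δ * K)) (by linarith)
      (hint K)
    rw [← ofReal_measureReal]
    refine ENNReal.ofReal_le_ofReal (h1.trans ?_)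
    have h2 : mgf (S K) Pr (-θ) ≤ Real.exp (θ ^ 2 * B ^ 2) ^ K :=
      (hM K).trans (pow_le_pow_left₀ (by positivity)
        (by linarith [Real.add_one_le_exp (θ ^ 2 * B ^ 2)]) K)
    calc _ ≤ Real.exp (- -θ * -(δ * K)) * Real.exp (θ ^ 2 * B ^ 2) ^ K :=
          mul_le_mul_of_nonneg_left h2 (Real.exp_pos _).le
      _ = Real.exp (K * (θ ^ 2 * B ^ 2 - θ * δ)) := by
          rw [← Real.exp_nat_mul, ← Real.exp_add]; congr 1; ring
      _ ≤ Real.exp (K * -(θ * δ / 2)) := by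
          refine Real.exp_le_exp.2 (mul_le_mul_of_nonneg_left ?_ K.cast_nonneg)
          nlinarith [mul_le_mul_of_nonneg_left hθδ hθ0.le]
      _ = _ := by rw [Real.exp_nat_mul]
  have hsum : ∑' K, Pr {ω | S K ω ≤ -(δ * K)} ≠ ⊤ := by
    refine ne_top_of_le_ne_top ?_ (ENNReal.tsum_le_tsum hprob)
    have hgeo : Summable fun K : ℕ => Real.exp (-(θ * δ / 2)) ^ K :=
      summable_geometric_of_lt_one (Real.exp_pos _).le (Real.exp_lt_one_iff.2 (by
        have := mul_pos hθ0 hδ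
        linarith))
    rw [← ENNReal.ofReal_tsum_of_nonneg (fun K => by positivity) hgeo]
    exact ENNReal.ofReal_ne_top
  filter_upwards [ae_eventually_notMem hsum] with ω hω
  filter_upwards [hω] with K hK
  have hK : ¬ (S K ω ≤ -(δ * K)) := hK
  exact (not_le.1 hK).le

/-! ### Jobs sent to a given half of the servers -/

section Drift

variable {n c : ℕ} (P : Policy n c) (μ : Fin n → ℝ≥0) (N : Finset (Fin n)) (w₀ : ℝ≥0)

/-- Indicator that a job of size at least `w₀` is sent to `N`, plus `b` times the number of queried
servers. -/
noncomputable def gain (b : ℝ) (s : State n c) (ξ : ℝ≥0 × unitInterval × unitInterval) : ℝ :=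
  (if w₀ ≤ ξ.1 ∧ destination P μ s ξ.1 ξ.2.1 ξ.2.2 ∈ N then 1 else 0) +
    b * (queried P s ξ.1 ξ.2.1).card

theorem measurable_gain (b : ℝ) : Measurable fun y : State n c × ℝ≥0 × unitInterval × unitInterval =>
    gain P μ N w₀ b y.1 y.2 := by
  have hs : Measurable fun y : State n c × ℝ≥0 × unitInterval × unitInterval => y.1 :=
    measurable_fst
  have hξ : Measurable fun y : State n c × ℝ≥0 × unitInterval × unitInterval => y.2 :=
    measurable_snd
  have hS := P.measurable_f₁.comp (hs.snd.fst.prodMk (hξ.fst.prodMk hξ.snd.fst))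
  have hr := measurable_report μ hs.fst hS
  have hD := P.measurable_f₂.comp
    (hs.snd.fst.prodMk (hξ.fst.prodMk (hr.prodMk hξ.snd.snd)))
  refine Measurable.add (Measurable.ite ?_ measurable_const measurable_const) ?_
  · exact (measurableSet_le measurable_const hξ.fst).inter (hD N.measurableSet)
  · exact ((measurable_of_countable fun S : Finset (Fin n) => (S.card : ℝ)).comp hS).const_mul b

theorem gain_nonneg {b : ℝ} (hb : 0 ≤ b) (s : State n c) (ξ : ℝ≥0 × unitInterval × unitInterval) :
    0 ≤ gain P μ N w₀ b s ξ := by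
  unfold gain; positivity

theorem gain_le {b : ℝ} (hb : 0 ≤ b) (s : State n c) (ξ : ℝ≥0 × unitInterval × unitInterval) :
    gain P μ N w₀ b s ξ ≤ 1 + b * n := by
  unfold gain
  have h1 : ((queried P s ξ.1 ξ.2.1).card : ℝ) ≤ n := by
    have := Finset.card_le_univ (queried P s ξ.1 ξ.2.1)
    rw [Fintype.card_fin] at this
    exact_mod_cast this
  refine add_le_add ?_ (mul_le_mul_of_nonneg_left h1 hb)
  split_ifs <;> norm_num

theorem integrable_gain {b : ℝ} (hb : 0 ≤ b) (s : State n c)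
    (ρ : Measure (ℝ≥0 × unitInterval × unitInterval)) [IsFiniteMeasure ρ] :
    Integrable (gain P μ N w₀ b s) ρ := by
  refine Integrable.of_bound
    ((measurable_gain P μ N w₀ b).comp measurable_prodMk_left).aestronglyMeasurable (1 + b * n)
    (Eventually.of_forall fun ξ => ?_)
  have h0 := gain_nonneg P μ N w₀ hb s ξ
  rw [Real.norm_eq_abs]
  change |gain P μ N w₀ b s ξ| ≤ _
  rw [abs_of_nonneg h0]
  exact gain_le P μ N w₀ hb s ξ

variable {P N}

/-- Sizes below `w₀` have nonnegative gain and are discarded. For the others the bound holds at each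
fixed size, since the policy may use the size in its decisions. -/
theorem Policy.WeaklySymmetric.le_integral_gain (hP : P.WeaklySymmetric) (hn : 8 ≤ n)
    (hc : 2 ^ c < n) (hN : N.card = n / 2) {x₀ : ℝ} (hx : x₀ + 1 ≤ n / 4)
    (F : Measure ℝ≥0) [IsProbabilityMeasure F] (s : State n c) :
    F.real (Set.Ici w₀) * (Real.exp (-(Real.log 4 * x₀)) / 4 * (1 + Real.log 4 * x₀)) ≤
      ∫ ξ, gain P μ N w₀ (Real.exp (-(Real.log 4 * x₀)) / 4 * Real.log 4) s ξ
        ∂(F.prod (volume.prod volume)) := by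
  set b := Real.exp (-(Real.log 4 * x₀)) / 4 * Real.log 4 with hbdef
  have hb : 0 ≤ b := by have := one_lt_log_four; positivity
  set A := Real.exp (-(Real.log 4 * x₀)) / 4 * (1 + Real.log 4 * x₀) with hA
  have hI := integrable_gain P μ N w₀ hb s (F.prod (volume.prod volume))
  rw [integral_prod _ hI]
  have hin : ∀ w, Set.indicator (Set.Ici w₀) (fun _ => A) w ≤
      ∫ y, gain P μ N w₀ b s (w, y) ∂((volume : Measure unitInterval).prod volume) := by
    intro w
    by_cases hw : w₀ ≤ w
    · rw [Set.indicator_of_mem (Set.mem_Ici.2 hw)]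
      have hI2 : Integrable (fun y => gain P μ N w₀ b s (w, y))
          ((volume : Measure unitInterval).prod volume) := by
        refine Integrable.of_bound ((measurable_gain P μ N w₀ b).comp
          (measurable_const.prodMk (measurable_const.prodMk measurable_id))).aestronglyMeasurable
          (1 + b * n) (Eventually.of_forall fun y => ?_)
        have h0 := gain_nonneg P μ N w₀ hb s (w, y)
        rw [Real.norm_eq_abs]
        change |gain P μ N w₀ b s (w, y)| ≤ _
        rw [abs_of_nonneg h0]
        exact gain_le P μ N w₀ hb s (w, y)
      rw [integral_prod _ hI2]
      refine (hP.le_integral_send hn hc s.2.1 w s.1 μ hN hx).trans_eq ?_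
      refine integral_congr_ae (Eventually.of_forall fun u => ?_)
      simp only [gain, hw, true_and, queried, destination]
      rw [integral_add, integral_const]
      · simp [hbdef]
      · refine Integrable.of_bound ((measurable_of_countable fun i : Fin n =>
          if i ∈ N then (1 : ℝ) else 0).comp (P.measurable_f₂_apply s.2.1 w
            (report s.1 μ (P.f₁ s.2.1 w u)))).aestronglyMeasurable 1
          (Eventually.of_forall fun v => ?_)
        split_ifs <;> simp
      · exact integrable_const _
    · rw [Set.indicator_of_notMem (by simpa using hw)]
      exact integral_nonneg fun y => gain_nonneg P μ N w₀ hb s (w, y)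
  calc F.real (Set.Ici w₀) * A = ∫ w, Set.indicator (Set.Ici w₀) (fun _ => A) w ∂F := by
        rw [integral_indicator measurableSet_Ici, setIntegral_const, smul_eq_mul]
    _ ≤ _ := integral_mono ((integrable_const A).indicator measurableSet_Ici) hI.integral_prod_left
        hin

/-- The increments are the gains minus the lower bound of their conditional mean. The threshold `w₀`
keeps them bounded without any moment condition on the sizes. -/
theorem ae_eventually_le_sum_gain (hP : P.WeaklySymmetric) (hn : 8 ≤ n)
    (hc : 2 ^ c < n) (hN : N.card = n / 2) {x₀ : ℝ} (hx : x₀ + 1 ≤ n / 4)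
    (G F : Measure ℝ≥0) [IsProbabilityMeasure G] [IsProbabilityMeasure F] (x : State n c) {δ : ℝ}
    (hδ : 0 < δ) : ∀ᵐ ω ∂(baseLaw G F), ∀ᶠ K : ℕ in atTop,
      (F.real (Set.Ici w₀) * (Real.exp (-(Real.log 4 * x₀)) / 4 * (1 + Real.log 4 * x₀)) - δ) * K ≤
        ∑ j ∈ Finset.range K, ((if w₀ ≤ jobSize ω j ∧ destinationAt P μ x ω j ∈ N then 1 else 0) +
          Real.exp (-(Real.log 4 * x₀)) / 4 * Real.log 4 * (queriedAt P μ x ω j).card) := by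
  set b := Real.exp (-(Real.log 4 * x₀)) / 4 * Real.log 4 with hbdef
  have hb : 0 ≤ b := by have := one_lt_log_four; positivity
  set A := F.real (Set.Ici w₀) *
    (Real.exp (-(Real.log 4 * x₀)) / 4 * (1 + Real.log 4 * x₀)) with hA
  set Y : ℕ → Sample → ℝ := fun j ω =>
    gain P μ N w₀ b (preState P μ x ω j) (jobSize ω j, unif ω 0 j, unif ω 1 j) - A with hY
  have hYm : ∀ j, Measurable (Y j) := fun j =>
    ((measurable_gain P μ N w₀ b).comp ((measurable_preState P μ x j).prodMk
      ((measurable_jobSize measurable_id measurable_const).prodMk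
        ((measurable_unif 0 measurable_id measurable_const).prodMk
          (measurable_unif 1 measurable_id measurable_const))))).sub_const A
  have hYR : ∀ j ω ξ, Y j (resample j (ω, ξ)) = gain P μ N w₀ b (preState P μ x ω j) ξ - A := by
    intro j ω ξ
    obtain ⟨h1, h2, h3⟩ := resample_apply j (ω, ξ)
    simp only [hY, h1, h2, h3, (agreeOff_resample j (ω, ξ)).preState_eq x le_rfl]
  have key := ae_eventually_le_sum (measurePreserving_resample G F) (Y := Y) hYm
    (B := 1 + b * n + |A|) ?_ ?_ ?_ hδ
  · filter_upwards [key] with ω hω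
    filter_upwards [hω] with K hK
    simp only [hY, Finset.sum_sub_distrib, Finset.sum_const, Finset.card_range, nsmul_eq_mul] at hK
    change _ ≤ ∑ j ∈ Finset.range K,
      gain P μ N w₀ b (preState P μ x ω j) (jobSize ω j, unif ω 0 j, unif ω 1 j)
    linarith
  · intro j ω
    refine (abs_sub _ _).trans (add_le_add ?_ le_rfl)
    rw [abs_of_nonneg (gain_nonneg P μ N w₀ hb _ _)]
    exact gain_le P μ N w₀ hb _ _
  · intro i j hij p
    have hA := agreeOff_resample j p
    simp only [hY, hA.preState_eq x hij.le, hA.size i hij.ne, hA.unif_eq _ i (Or.inl hij.ne)]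
  · intro j ω
    simp only [hYR]
    rw [integral_sub (integrable_gain P μ N w₀ hb _ _) (integrable_const _), integral_const]
    have := hP.le_integral_gain μ w₀ hn hc hN hx F (preState P μ x ω j)
    simp only [probReal_univ, one_smul]
    linarith

end Drift

/-! ### Arrival and message times -/

theorem ae_tendsto_average (ν : Measure ℝ≥0) [IsProbabilityMeasure ν] {f : ℝ≥0 → ℝ}
    (hf : Measurable f) (hi : Integrable f ν) :
    ∀ᵐ y ∂(Measure.infinitePi fun _ : ℕ => ν), Tendsto
      (fun k : ℕ => (∑ i ∈ Finset.range k, f (y i)) / k) atTop (nhds (∫ y, f y ∂ν)) := by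
  have hmp := fun i : ℕ => measurePreserving_eval_infinitePi (fun _ : ℕ => ν) i
  have hmean : ∫ y, f (y 0) ∂(Measure.infinitePi fun _ : ℕ => ν) = ∫ y, f y ∂ν := by
    conv_rhs => rw [← (hmp 0).map_eq]
    rw [integral_map (hmp 0).measurable.aemeasurable hf.aestronglyMeasurable]
  have hind : iIndepFun (fun (i : ℕ) (y : ℕ → ℝ≥0) => f (y i))
      (Measure.infinitePi fun _ : ℕ => ν) :=
    iIndepFun_infinitePi (X := fun _ => f) fun _ => hf
  have := strong_law_ae_real (μ := Measure.infinitePi fun _ : ℕ => ν)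
    (fun i y => f (y i)) ((hmp 0).integrable_comp_of_integrable hi)
    (fun i j hij => hind.indepFun hij) (fun i => ⟨(hf.comp (measurable_pi_apply i)).aemeasurable,
      (hf.comp (measurable_pi_apply 0)).aemeasurable, by
        change Measure.map (f ∘ fun y : ℕ → ℝ≥0 => y i) _ =
          Measure.map (f ∘ fun y : ℕ → ℝ≥0 => y 0) _
        rw [← Measure.map_map hf (hmp i).measurable, ← Measure.map_map hf (hmp 0).measurable,
          (hmp i).map_eq, (hmp 0).map_eq]⟩)
  rwa [hmean] at this

/-- A minorant `f` suffices, which lets the exponential gaps be truncated at `1` so that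
integrability is immediate. -/
theorem exists_lt_sum_of_average {y : ℕ → ℝ≥0} {f : ℝ≥0 → ℝ} (hf : ∀ y, f y ≤ y) {m : ℝ}
    (hm : 0 < m) (h : Tendsto (fun k : ℕ => (∑ i ∈ Finset.range k, f (y i)) / k) atTop (nhds m))
    (t : ℝ≥0) : ∃ k, t < ∑ i ∈ Finset.range (k + 1), y i := by
  have h1 : Tendsto (fun k : ℕ => (∑ i ∈ Finset.range k, f (y i)) / k * k) atTop atTop :=
    h.pos_mul_atTop hm tendsto_natCast_atTop_atTop
  have h2 := (h1.eventually_gt_atTop (t : ℝ)).and (eventually_ge_atTop 1)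
  obtain ⟨k, hk, hk1⟩ := h2.exists
  refine ⟨k - 1, ?_⟩
  rw [Nat.sub_add_cancel hk1, ← NNReal.coe_lt_coe, NNReal.coe_sum]
  have hk0 : (k : ℝ) ≠ 0 := by positivity
  rw [div_mul_cancel₀ _ hk0] at hk
  exact hk.trans_le (Finset.sum_le_sum fun i _ => hf _)

theorem integrable_min_unitExp : Integrable (fun y : ℝ≥0 => min (y : ℝ) 1) unitExp :=
  Integrable.of_bound (by fun_prop) 1 (Eventually.of_forall fun y => by
    rw [Real.norm_eq_abs, abs_of_nonneg (le_min y.coe_nonneg zero_le_one)]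
    exact min_le_right _ _)

theorem integral_min_unitExp_pos : 0 < ∫ y : ℝ≥0, min (y : ℝ) 1 ∂unitExp := by
  rw [integral_pos_iff_support_of_nonneg (fun y => le_min y.2 zero_le_one) integrable_min_unitExp]
  have hsupp : Function.support (fun y : ℝ≥0 => min (y : ℝ) 1) = Set.Ioi 0 := by
    ext y
    simp only [Function.mem_support, Set.mem_Ioi]
    constructor
    · intro h
      rw [pos_iff_ne_zero]
      rintro rfl
      simp at h
    · intro h
      have : (0 : ℝ) < y := h
      exact (lt_min this one_pos).ne'
  rw [hsupp, unitExp, Measure.map_apply measurable_real_toNNReal measurableSet_Ioi]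
  have hpre : Real.toNNReal ⁻¹' Set.Ioi 0 = (Set.Iic 0)ᶜ := by
    ext y; simp
  have : IsProbabilityMeasure (expMeasure 1) := isProbabilityMeasure_expMeasure one_pos
  have hz : expMeasure 1 (Set.Iic 0) = 0 := by
    have h1 := cdf_expMeasure_eq one_pos 0
    rw [cdf_eq_real] at h1
    simpa [measureReal_eq_zero_iff] using h1
  rw [hpre, prob_compl_eq_one_sub measurableSet_Iic, hz]
  simp

theorem ae_message (G F : Measure ℝ≥0) [IsProbabilityMeasure G] [IsProbabilityMeasure F]
    (β : ℝ≥0) : ∀ᵐ ω ∂(baseLaw G F), ∀ t : ℝ≥0, ∃ k, (t : ℝ≥0∞) < messageTime β ω k := by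
  have h := ae_tendsto_average unitExp (f := fun y => min (y : ℝ) 1) (by fun_prop) integrable_min_unitExp
  have h' := (Measure.quasiMeasurePreserving_fst.comp Measure.quasiMeasurePreserving_snd :
    Measure.QuasiMeasurePreserving (fun ω : Sample => ω.2.1) (baseLaw G F) _).ae h
  filter_upwards [h'] with ω hω t
  obtain ⟨k, hk⟩ := exists_lt_sum_of_average (fun y => min_le_left _ _)
    integral_min_unitExp_pos hω (t * β)
  refine ⟨k, ?_⟩
  rw [messageTime]
  -- At rate zero, a positive sum of gaps divided by `0` is `∞`.
  rcases eq_or_ne β 0 with rfl | hβ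
  · rw [ENNReal.coe_zero, ENNReal.div_zero (by
      rw [ENNReal.coe_ne_zero]; exact (zero_le.trans_lt hk).ne')]
    exact ENNReal.coe_lt_top
  · rw [ENNReal.lt_div_iff_mul_lt (Or.inl (by simpa using hβ)) (Or.inl ENNReal.coe_ne_top)]
    exact_mod_cast hk

theorem ae_arrival (G F : Measure ℝ≥0) [IsProbabilityMeasure G] [IsProbabilityMeasure F] {m : ℝ}
    (hm : 0 < m) (hG : ∫⁻ y, (y : ℝ≥0∞) ∂G = ENNReal.ofReal m) :
    ∀ᵐ ω ∂(baseLaw G F), Tendsto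
      (fun k : ℕ => (∑ i ∈ Finset.range k, (ω.1 i : ℝ)) / k) atTop (nhds m) := by
  have hmeas : Measurable fun y : ℝ≥0 => (y : ℝ) := by fun_prop
  have hlin : ∫⁻ y : ℝ≥0, ENNReal.ofReal (y : ℝ) ∂G = ENNReal.ofReal m := by
    rw [← hG]; simp
  have hint : Integrable (fun y : ℝ≥0 => (y : ℝ)) G := by
    refine ⟨hmeas.aestronglyMeasurable, ?_⟩
    rw [hasFiniteIntegral_iff_ofReal (Eventually.of_forall fun y => y.2), hlin]
    exact ENNReal.ofReal_lt_top
  have hmean : ∫ y : ℝ≥0, (y : ℝ) ∂G = m := by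
    rw [integral_eq_lintegral_of_nonneg_ae (Eventually.of_forall fun y => y.2)
      hmeas.aestronglyMeasurable, hlin, ENNReal.toReal_ofReal hm.le]
  have h := ae_tendsto_average G hmeas hint
  rw [hmean] at h
  exact (Measure.quasiMeasurePreserving_fst :
    Measure.QuasiMeasurePreserving (fun ω : Sample => ω.1) (baseLaw G F) _).ae h

/-! ### Growth of the workload -/

section Growth

variable {n c : ℕ} {P : Policy n c} {μ : Fin n → ℝ≥0} {N : Finset (Fin n)}

theorem tendsto_arr_configAt (hμ : ∀ i, 0 < μ i) {x : State n c} {ω : Sample}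
    (hω : NonExplosive P.β x.2.2 ω) :
    Tendsto (fun t : ℝ≥0 => (configAt P μ x t ω).arr) atTop atTop := by
  refine tendsto_atTop.2 fun k => ?_
  filter_upwards [eventually_ge_atTop (arrivalTime x.2.2 ω k)] with t ht
  by_contra! h
  have h1 := (configAt_spec hμ hω t).1
  exact absurd (ht.trans_lt h1) (not_lt.2 (arrivalTime_mono _ _ h.le))

/-- By time `t` there are at least `r * t / 2` arrivals and at most `α * t` queries, so the
accumulated gain forces at least `(A * r / 2 - b * α) * t` jobs of size `w₀` or more into `N`. -/
theorem eventually_le_totalWorkload (hμ : ∀ i, 0 < μ i) {x : State n c} {ω : Sample}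
    (hω : NonExplosive P.β x.2.2 ω) {r A b α : ℝ} {w₀ : ℝ≥0} (hA : 0 ≤ A) (hb : 0 ≤ b)
    (hα : 0 < α) (hT : ∀ᶠ k : ℕ in atTop, r * arrivalTime x.2.2 ω k ≤ 2 * k)
    (hgain : ∀ᶠ K : ℕ in atTop, A * K ≤ ∑ j ∈ Finset.range K,
      ((if w₀ ≤ jobSize ω j ∧ destinationAt P μ x ω j ∈ N then 1 else 0) +
        b * (queriedAt P μ x ω j).card)) (hr : 0 ≤ r)
    (hmsg : messageRate P μ x ω ≤ ENNReal.ofReal α) :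
    ∀ᶠ t : ℝ≥0 in atTop,
      (w₀ * (A * r / 2 - b * α) - (∑ i ∈ N, μ i : ℝ≥0)) * t ≤ totalWorkload P μ x t ω := by
  have hlim := tendsto_arr_configAt hμ hω
  -- A bound on the limsup becomes an eventual bound only with some slack; the factor `2` spent here
  -- is recovered because each query costs two messages.
  have hm2 : ∀ᶠ t : ℝ≥0 in atTop, ((configAt P μ x t ω).msgs : ℝ≥0∞) / (t : ℝ≥0∞) <
      ENNReal.ofReal (2 * α) := by
    refine eventually_lt_of_limsup_lt (hmsg.trans_lt ?_)
    exact (ENNReal.ofReal_lt_ofReal_iff (by linarith)).2 (by linarith)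
  filter_upwards [hlim.eventually hT, hlim.eventually hgain, hm2, eventually_gt_atTop 0]
    with t ht1 ht2 ht3 ht0
  obtain ⟨s1, s2, s3⟩ := configAt_spec hμ hω t
  set K := (configAt P μ x t ω).arr
  have ht0' : (0 : ℝ) < t := ht0
  have e1 : r * t ≤ 2 * K :=
    (mul_le_mul_of_nonneg_left (NNReal.coe_le_coe.2 s1.le) hr).trans ht1
  have e2 : ((configAt P μ x t ω).msgs : ℝ) ≤ 2 * α * t := by
    rw [ENNReal.div_lt_iff (Or.inl (by simpa using ht0.ne')) (Or.inl ENNReal.coe_ne_top),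
      ← ENNReal.ofReal_coe_nnreal, ← ENNReal.ofReal_mul (by linarith),
      ← ENNReal.ofReal_natCast] at ht3
    exact ((ENNReal.ofReal_lt_ofReal_iff (by positivity)).1 ht3).le
  have e3 : (∑ j ∈ Finset.range K, ((queriedAt P μ x ω j).card : ℝ)) ≤ α * t := by
    have : 2 * (∑ j ∈ Finset.range K, ((queriedAt P μ x ω j).card : ℝ)) ≤
        (configAt P μ x t ω).msgs := by exact_mod_cast s2
    linarith
  have e4 : (w₀ : ℝ) * ∑ j ∈ Finset.range K,
      (if w₀ ≤ jobSize ω j ∧ destinationAt P μ x ω j ∈ N then (1 : ℝ) else 0) ≤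
      totalWorkload P μ x t ω + (∑ i ∈ N, μ i : ℝ≥0) * t := by
    have h1 := NNReal.coe_le_coe.2 (s3 N)
    rw [NNReal.coe_sum, NNReal.coe_add, NNReal.coe_mul] at h1
    refine le_trans ?_ h1
    rw [Finset.mul_sum]
    refine Finset.sum_le_sum fun j _ => ?_
    by_cases hd : destinationAt P μ x ω j ∈ N
    · by_cases hw : w₀ ≤ jobSize ω j
      · simp [hd, hw]
      · simp [hd, hw]
    · simp [hd]
  rw [Finset.sum_add_distrib, ← Finset.mul_sum] at ht2
  have e5 : A * r / 2 * t - b * (α * t) ≤ ∑ j ∈ Finset.range K,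
      (if w₀ ≤ jobSize ω j ∧ destinationAt P μ x ω j ∈ N then (1 : ℝ) else 0) := by
    have h1 := mul_le_mul_of_nonneg_left e1 hA
    have h2 := mul_le_mul_of_nonneg_left e3 hb
    linarith
  have e6 := mul_le_mul_of_nonneg_left e5 w₀.coe_nonneg
  linarith

theorem ae_eventually_arrivalTime_le (G F : Measure ℝ≥0) [IsProbabilityMeasure G]
    [IsProbabilityMeasure F] {r : ℝ} (hr : 0 < r)
    (hG : ∫⁻ y, (y : ℝ≥0∞) ∂G = ENNReal.ofReal (1 / r)) (z : ℝ≥0) :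
    ∀ᵐ ω ∂(baseLaw G F), (∀ t : ℝ≥0, ∃ k, t < arrivalTime z ω k) ∧
      ∀ᶠ k : ℕ in atTop, r * arrivalTime z ω k ≤ 2 * k := by
  have hm : 0 < 1 / r := by positivity
  filter_upwards [ae_arrival G F hm hG] with ω hω
  constructor
  · intro t
    obtain ⟨k, hk⟩ := exists_lt_sum_of_average (f := fun y => (y : ℝ)) (fun y => le_rfl) hm hω
      (t + z)
    exact ⟨k, lt_tsub_iff_right.2 hk⟩
  -- Arrival number `k` involves `k + 1` gaps, and `3 / 2 * (k + 1) ≤ 2 * k` from `k = 3` on.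
  · have h1 : ∀ᶠ k : ℕ in atTop,
        (∑ i ∈ Finset.range k, (ω.1 i : ℝ)) / k < 3 / 2 * (1 / r) :=
      hω.eventually_lt_const (by linarith)
    filter_upwards [(tendsto_add_atTop_nat 1).eventually h1, eventually_ge_atTop 3] with k hk hk3
    have hk3' : (3 : ℝ) ≤ k := by exact_mod_cast hk3
    rw [div_lt_iff₀ (by positivity)] at hk
    have h2 : (arrivalTime z ω k : ℝ) ≤ ∑ i ∈ Finset.range (k + 1), (ω.1 i : ℝ) := by
      have : arrivalTime z ω k ≤ ∑ i ∈ Finset.range (k + 1), ω.1 i := tsub_le_self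
      exact_mod_cast this
    have h3 : r * (3 / 2 * (1 / r) * ((k + 1 : ℕ) : ℝ)) = 3 / 2 * (k + 1) := by
      push_cast; field_simp
    have h4 := mul_le_mul_of_nonneg_left (h2.trans hk.le) hr.le
    rw [h3] at h4
    linarith

/-- Almost sure statements proved for independent coordinates thus carry over to the conditioned
first interarrival time. -/
theorem lawFrom_absolutelyContinuous (G F : Measure ℝ≥0) (z : ℝ≥0) :
    lawFrom G F z ≪ baseLaw G F :=
  cond_absolutelyContinuous

theorem isProbabilityMeasure_lawFrom (G F : Measure ℝ≥0) [IsProbabilityMeasure G]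
    [IsProbabilityMeasure F] {z : ℝ≥0} (hz : 0 < G (Set.Ioi z)) :
    IsProbabilityMeasure (lawFrom G F z) := by
  refine cond_isProbabilityMeasure ?_
  have hmp : MeasurePreserving (fun ω : Sample => ω.1 0) (baseLaw G F) G :=
    (measurePreserving_eval_infinitePi (fun _ : ℕ => G) 0).comp measurePreserving_fst
  have : baseLaw G F {ω : Sample | z < ω.1 0} = G (Set.Ioi z) :=
    hmp.measure_preimage measurableSet_Ioi.nullMeasurableSet
  rw [this]
  exact hz.ne'

/-- Linear growth of the workload when half of the servers are slow. -/
theorem ae_eventually_workload (hP : P.WeaklySymmetric) (hn : 8 ≤ n) (hc : 2 ^ c < n)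
    (hN : N.card = n / 2) (hμ : ∀ i, 0 < μ i) {ε : ℝ≥0} (hε : ∀ i ∈ N, μ i = ε)
    (G F : Measure ℝ≥0) [IsProbabilityMeasure G] [IsProbabilityMeasure F] {lam α p : ℝ}
    (hlam : 0 < lam) (hα : 0 < α) {w₀ : ℝ≥0} (hp : F.real (Set.Ici w₀) = p) (hp0 : 0 < p)
    (hG : ∫⁻ y, (y : ℝ≥0∞) ∂G = ENNReal.ofReal (1 / (lam * n)))
    (hx : 2 * α / (lam * n * p) + 1 ≤ n / 4) (x : State n c)
    (hmsg : ∀ᵐ ω ∂(lawFrom G F x.2.2), messageRate P μ x ω ≤ ENNReal.ofReal α) :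
    ∀ᵐ ω ∂(lawFrom G F x.2.2), ∀ᶠ t : ℝ≥0 in atTop,
      (lam * w₀ * p / 16 * Real.exp (-(2 * Real.log 4 / (lam * p) * (α / n))) - ε) * n * t ≤
        totalWorkload P μ x t ω := by
  have hn0 : (0 : ℝ) < n := by
    have : 0 < n := by omega
    exact_mod_cast this
  have hL := one_lt_log_four
  -- At this tangent point the term of the gain proportional to `x₀` cancels the cost of the queries
  -- exactly; see `hval`.
  set x₀ : ℝ := 2 * α / (lam * n * p) with hx₀
  set E : ℝ := Real.exp (-(Real.log 4 * x₀)) with hE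
  have hE0 : 0 < E := Real.exp_pos _
  -- Half of the remaining constant `p * (E / 4)` is given up; the other half, times `lam * n / 2`,
  -- produces the factor `1 / 16`.
  have hδ : 0 < p * (E / 4) / 2 := by positivity
  have hbase := (lawFrom_absolutelyContinuous G F x.2.2).ae_le
  filter_upwards [hmsg,
    hbase (ae_eventually_le_sum_gain μ w₀ hP hn hc hN hx G F x hδ),
    hbase (ae_eventually_arrivalTime_le G F (r := lam * n) (by positivity) hG x.2.2),
    hbase (ae_message G F P.β)] with ω h1 h2 h3 h4
  have hexp : Real.exp (-(2 * Real.log 4 / (lam * p) * (α / n))) = E := by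
    rw [hE, hx₀]; congr 1; field_simp
  have key := eventually_le_totalWorkload (N := N) hμ ⟨h3.1, h4⟩ ?_ ?_ hα h3.2 h2
    (by positivity) h1
  · filter_upwards [key] with t ht
    refine le_trans ?_ ht
    refine mul_le_mul_of_nonneg_right ?_ t.coe_nonneg
    have hsum : ((∑ i ∈ N, μ i : ℝ≥0) : ℝ) ≤ ε * n := by
      rw [Finset.sum_congr rfl hε, Finset.sum_const, hN, nsmul_eq_mul, NNReal.coe_mul,
        NNReal.coe_natCast, mul_comm]
      refine mul_le_mul_of_nonneg_left ?_ ε.coe_nonneg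
      exact_mod_cast Nat.div_le_self n 2
    have hval : (F.real (Set.Ici w₀) * (E / 4 * (1 + Real.log 4 * x₀)) - p * (E / 4) / 2) *
        (lam * n) / 2 - E / 4 * Real.log 4 * α = lam * p / 16 * E * n := by
      rw [hp, hx₀]; field_simp; ring
    rw [hval, hexp]
    calc _ = w₀ * (lam * p / 16 * E * n) - ε * n := by ring
      _ ≤ _ := by linarith
  · rw [hp]
    have : 0 ≤ Real.log 4 * x₀ := by positivity
    nlinarith [mul_nonneg (mul_pos hp0 hE0).le this, mul_pos hp0 hE0]
  · positivity

theorem le_workloadGrowth {x : State n c} {ω : Sample} {r : ℝ}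
    (h : ∀ᶠ t : ℝ≥0 in atTop, r * t ≤ totalWorkload P μ x t ω) :
    ENNReal.ofReal r ≤ workloadGrowth P μ x ω := by
  refine le_liminf_of_le (by isBoundedDefault) ?_
  filter_upwards [h, eventually_gt_atTop 0] with t ht ht0
  rw [ENNReal.le_div_iff_mul_le (Or.inl (by simpa using ht0.ne')) (Or.inl ENNReal.coe_ne_top),
    ← ENNReal.ofReal_coe_nnreal (p := t), ← ENNReal.ofReal_mul' t.coe_nonneg,
    ← ENNReal.ofReal_coe_nnreal]
  exact ENNReal.ofReal_le_ofReal ht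

/-- A process whose workload tends to infinity is not positive Harris recurrent. -/
theorem notMem_stabilityRegion {G F : Measure ℝ≥0} [IsProbabilityMeasure G]
    [IsProbabilityMeasure F] {x : State n c} (hx : x ∈ stateSpace n c G) {r : ℝ} (hr : 0 < r)
    (h : ∀ᵐ ω ∂(lawFrom G F x.2.2), ∀ᶠ t : ℝ≥0 in atTop, r * t ≤ totalWorkload P μ x t ω) :
    μ ∉ stabilityRegion P G F := by
  rintro ⟨-, ⟨φ, -, hφ0, -, hφ⟩, -⟩
  have := isProbabilityMeasure_lawFrom G F hx.2
  -- These sublevel sets exhaust the state space, so one has positive `φ`-measure. A path with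
  -- growing workload occupies it only within a bounded interval of time.
  let A : ℕ → Set (State n c) := fun R => {s | workloadOn Finset.univ s ≤ R}
  have hAm : ∀ R, MeasurableSet (A R) := fun R => by
    refine measurableSet_le ?_ measurable_const
    exact Finset.measurable_sum _ fun i _ =>
      measurable_queue_sum.comp ((measurable_pi_apply i).comp measurable_fst)
  obtain ⟨R, hR⟩ : ∃ R, 0 < φ (A R) := by
    by_contra! hall
    apply hφ0
    rw [← Measure.measure_univ_eq_zero]
    have huniv : (Set.univ : Set (State n c)) = ⋃ R, A R := by
      refine (Set.eq_univ_of_forall fun s => ?_).symm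
      obtain ⟨R, hR⟩ := exists_nat_ge (workloadOn Finset.univ s)
      exact Set.mem_iUnion.2 ⟨R, hR⟩
    rw [huniv]
    exact measure_iUnion_null fun R => le_antisymm (hall R) zero_le
  obtain ⟨ω, hω1, hω2⟩ := ((hφ (A R) (hAm R) hR x hx).and h).exists
  obtain ⟨T, hT⟩ := eventually_atTop.1 hω2
  have hsub : {t : ℝ | 0 ≤ t ∧ process P μ x t.toNNReal ω ∈ A R} ⊆
      Set.Icc 0 (max T (R / r)) := by
    rintro t ⟨ht0, ht⟩
    refine ⟨ht0, ?_⟩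
    by_contra! hlt
    obtain ⟨h1, h2⟩ := max_lt_iff.1 hlt
    have h3 := hT t.toNNReal (by
      rw [← NNReal.coe_le_coe, Real.coe_toNNReal t ht0]; exact h1.le)
    rw [Real.coe_toNNReal t ht0] at h3
    have h4 : (totalWorkload P μ x t.toNNReal ω : ℝ) ≤ R := by
      have : totalWorkload P μ x t.toNNReal ω ≤ R := ht
      exact_mod_cast this
    rw [div_lt_iff₀ hr] at h2
    linarith
  have := measure_mono (μ := volume) hsub
  rw [hω1, Real.volume_Icc] at this
  exact absurd this (not_le.2 ENNReal.ofReal_lt_top)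

end Growth

/-! ### Constants from the job size law and asymptotics in `n`. -/

theorem exists_pos_measure_Ici {F : Measure ℝ≥0} (h : ∫⁻ w, (w : ℝ≥0∞) ∂F = 1) :
    ∃ w₀ : ℝ≥0, 0 < w₀ ∧ F (Set.Ici w₀) ≠ 0 := by
  by_contra! hall
  have h0 : F (Set.Ioi 0) = 0 := by
    have : Set.Ioi (0 : ℝ≥0) ⊆ ⋃ k : ℕ, Set.Ici (1 / ((k : ℝ≥0) + 1)) := by
      intro w hw
      obtain ⟨k, hk⟩ := exists_nat_one_div_lt (show (0 : ℝ≥0) < w from hw)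
      exact Set.mem_iUnion.2 ⟨k, hk.le⟩
    refine measure_mono_null this (measure_iUnion_null fun k => hall _ (by positivity))
  have h1 : (fun w : ℝ≥0 => (w : ℝ≥0∞)) =ᵐ[F] fun _ => 0 := by
    refine measure_mono_null (fun w hw => ?_) h0
    exact pos_iff_ne_zero.2 (by simpa using hw)
  rw [lintegral_congr_ae h1] at h
  simp at h

theorem eventually_two_pow_lt {c : ℕ+ → ℕ}
    (h : (fun n : ℕ+ => (c n : ℝ)) =o[atTop] fun n : ℕ+ => Real.log (n : ℕ)) :
    ∀ᶠ n : ℕ+ in atTop, 2 ^ c n < (n : ℕ) := by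
  filter_upwards [h.bound (show (0 : ℝ) < 1 / 2 by norm_num), eventually_ge_atTop 2] with n hn hn2
  have hn2' : (1 : ℝ) < (n : ℕ) := by
    have : (2 : ℕ) ≤ n := hn2
    exact_mod_cast this
  have hlog := Real.log_pos hn2'
  rw [Real.norm_of_nonneg (Nat.cast_nonneg _), Real.norm_of_nonneg hlog.le] at hn
  have h1 : (2 : ℝ) ^ c n < (n : ℕ) := by
    calc (2 : ℝ) ^ c n ≤ Real.exp 1 ^ c n :=
          pow_le_pow_left₀ (by norm_num) (by linarith [Real.add_one_le_exp 1]) _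
      _ = Real.exp (c n) := by rw [← Real.exp_nat_mul, mul_one]
      _ < Real.exp (Real.log (n : ℕ)) := Real.exp_lt_exp.2 (by linarith)
      _ = _ := Real.exp_log (by linarith)
  exact_mod_cast h1

theorem tendsto_pnat_atTop : Tendsto (fun n : ℕ+ => ((n : ℕ) : ℝ)) atTop atTop :=
  tendsto_natCast_atTop_atTop.comp (tendsto_atTop.2 fun k => by
    filter_upwards [eventually_ge_atTop (⟨k + 1, k.succ_pos⟩ : ℕ+)] with n hn
    have : k + 1 ≤ (n : ℕ) := hn
    omega)

/-- This keeps the tangent point, of the form `κ * α / n`, below `n / 4`. The terms `α n * κ / n`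
and `1` receive `n / 8` each, whence the constant `8`. -/
theorem eventually_query_bound {α : ℕ+ → ℝ} {κ : ℝ} (hκ : 0 < κ)
    (h : α =o[atTop] fun n : ℕ+ => ((n : ℕ) : ℝ) ^ 2) :
    ∀ᶠ n : ℕ+ in atTop, α n * κ / (n : ℕ) + 1 ≤ (n : ℕ) / 4 := by
  filter_upwards [h.bound (show 0 < 1 / (8 * κ) by positivity),
    tendsto_pnat_atTop.eventually_ge_atTop 8] with n hn hn8
  rw [Real.norm_of_nonneg (sq_nonneg ((n : ℕ) : ℝ))] at hn
  have h1 := (le_abs_self _).trans hn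
  have h2 : α n * κ / (n : ℕ) ≤ (n : ℕ) / 8 := by
    rw [div_le_iff₀ (by linarith)]
    calc α n * κ ≤ 1 / (8 * κ) * ((n : ℕ) : ℝ) ^ 2 * κ := mul_le_mul_of_nonneg_right h1 hκ.le
      _ = _ := by field_simp
  linarith

/-- The second part of the theorem, for one job size law. -/
theorem exists_growth_constants {lam : ℝ} (hlam : 0 < lam) (F : Measure ℝ≥0)
    [IsProbabilityMeasure F] (hF : ∫⁻ w, (w : ℝ≥0∞) ∂F = 1) :
    ∃ a > (0 : ℝ), ∃ K > (0 : ℝ),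
      ∀ (α : ℕ+ → ℝ) (G : ℕ+ → Measure ℝ≥0) (c : ℕ+ → ℕ) (P : ∀ n : ℕ+, Policy n (c n))
        (ν : ∀ n : ℕ+, (Fin n → ℝ≥0) → Measure (State n (c n))), Admissible lam α F G c P ν →
        ∀ᶠ n : ℕ+ in atTop, ∀ μ ∈ rateSet n, ∀ (ε : ℝ≥0) (N : Finset (Fin n)),
          N.card = (n : ℕ) / 2 → (∀ i ∈ N, μ i = ε) →
          (∀ᵐ x ∂(ν n μ), ∀ᵐ ω ∂(lawFrom (G n) F x.2.2),
            ENNReal.ofReal ((a * Real.exp (-(K * (α n / (n : ℕ)))) - ε) * (n : ℕ)) ≤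
              workloadGrowth (P n) μ x ω) ∧
          ((ε : ℝ) < a * Real.exp (-(K * (α n / (n : ℕ)))) →
            μ ∉ stabilityRegion (P n) (G n) F) := by
  obtain ⟨w₀, hw₀, hne⟩ := exists_pos_measure_Ici hF
  obtain ⟨p, hp⟩ : ∃ p, F.real (Set.Ici w₀) = p := ⟨_, rfl⟩
  have hp0 : 0 < p := by
    rw [← hp]; exact ENNReal.toReal_pos hne (measure_ne_top _ _)
  have hw₀' : (0 : ℝ) < w₀ := hw₀
  have hL := one_lt_log_four
  -- Both constants involve only `lam` and, through `w₀` and `p`, the law `F`.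
  refine ⟨lam * w₀ * p / 16, by positivity, 2 * Real.log 4 / (lam * p), by positivity, ?_⟩
  intro α G c P ν hadm
  filter_upwards [eventually_two_pow_lt hadm.memory,
    eventually_query_bound (show 0 < 2 / (lam * p) by positivity) hadm.message_order,
    eventually_ge_atTop (8 : ℕ+)] with n hc hx hn8 μ hμ ε N hN hε
  have := hadm.arrival_prob n
  have := hadm.initial_prob n μ hμ
  have hn8' : 8 ≤ (n : ℕ) := hn8
  have hn0 : (0 : ℝ) < (n : ℕ) := by exact_mod_cast n.pos
  have hx' : 2 * α n / (lam * (n : ℕ) * p) + 1 ≤ ((n : ℕ) : ℝ) / 4 := by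
    convert hx using 2
    field_simp
  have key : ∀ᵐ x ∂(ν n μ), ∀ᵐ ω ∂(lawFrom (G n) F x.2.2), ∀ᶠ t : ℝ≥0 in atTop,
      (lam * w₀ * p / 16 * Real.exp (-(2 * Real.log 4 / (lam * p) * (α n / (n : ℕ)))) - ε) *
        (n : ℕ) * t ≤ totalWorkload (P n) μ x t ω := by
    filter_upwards [hadm.message_rate n μ hμ] with x hmsg
    exact ae_eventually_workload (hadm.symmetric n) hn8' hc hN hμ.1 hε (G n) F hlam
      (hadm.message_pos n) hp hp0 (hadm.arrival_mean n) hx' x hmsg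
  refine ⟨?_, fun hlt => ?_⟩
  · filter_upwards [key] with x hx
    filter_upwards [hx] with ω hω
    exact le_workloadGrowth hω
  -- One admissible initial state is enough, because Harris recurrence concerns every starting
  -- point.
  · obtain ⟨x, hx1, hx2⟩ := (key.and (hadm.initial_mem n μ hμ)).exists
    exact notMem_stabilityRegion hx2 (mul_pos (sub_pos.2 hlt) hn0) hx1

/-! ### Rates outside every stability region -/

/-- Half of the servers have the rate `ε`, and the others share the remaining capacity. -/
noncomputable def slowHalfRates (n : ℕ) (ε : ℝ≥0) (i : Fin n) : ℝ≥0 :=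
  if (i : ℕ) < n / 2 then ε else (n - (n / 2 : ℕ) * ε) / (n - n / 2 : ℕ)

theorem card_filter_val_lt_half (n : ℕ) :
    (Finset.univ.filter fun i : Fin n => (i : ℕ) < n / 2).card = n / 2 := by
  rw [Fin.card_filter_val_lt]
  exact min_eq_right (Nat.div_le_self n 2)

theorem slowHalfRates_mem_rateSet {n : ℕ} (hn : 0 < n) {ε : ℝ≥0} (hε : 0 < ε) (hε1 : ε < 1) :
    slowHalfRates n ε ∈ rateSet n := by
  have hlt : ((n / 2 : ℕ) : ℝ≥0) * ε < n := by
    rcases Nat.eq_zero_or_pos (n / 2) with h | h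
    · rw [h]; simpa using hn
    · calc ((n / 2 : ℕ) : ℝ≥0) * ε < (n / 2 : ℕ) * 1 :=
            mul_lt_mul_of_pos_left hε1 (by exact_mod_cast h)
        _ ≤ n := by rw [mul_one]; exact_mod_cast Nat.div_le_self n 2
  have hpos : (0 : ℝ≥0) < (n - n / 2 : ℕ) := by
    have : 0 < n - n / 2 := by omega
    exact_mod_cast this
  refine ⟨fun i => ?_, ?_⟩
  · unfold slowHalfRates
    split_ifs
    · exact hε
    · exact div_pos (tsub_pos_of_lt hlt) hpos
  · have hcard : (Finset.univ.filter fun i : Fin n => ¬ (i : ℕ) < n / 2).card = n - n / 2 := by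
      have h1 := Finset.card_filter_add_card_filter_not (s := (Finset.univ : Finset (Fin n)))
        fun i : Fin n => (i : ℕ) < n / 2
      rw [card_filter_val_lt_half, Finset.card_fin] at h1
      omega
    unfold slowHalfRates
    rw [Finset.sum_ite, Finset.sum_const, Finset.sum_const, card_filter_val_lt_half, hcard,
      nsmul_eq_mul, nsmul_eq_mul, mul_div_cancel₀ _ hpos.ne', add_tsub_cancel_of_le hlt.le]

/-- A rate below `a * exp (-(K * r / n))` for all `a, K > 0` and all large `n`. -/
noncomputable def tinyRate (n : ℕ) (r : ℝ) : ℝ≥0 := (Real.exp (-(n + r))).toNNReal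

theorem coe_tinyRate (n : ℕ) (r : ℝ) : (tinyRate n r : ℝ) = Real.exp (-(n + r)) :=
  Real.coe_toNNReal _ (Real.exp_pos _).le

/-- The factor `exp (-n)` beats `a` once `n > -log a`, and `exp (-α n)` beats the other factor once
`n ≥ K`. -/
theorem eventually_tinyRate_lt {a K : ℝ} (ha : 0 < a) (α : ℕ+ → ℝ) (hα : ∀ n, 0 < α n) :
    ∀ᶠ n : ℕ+ in atTop, (tinyRate n (α n) : ℝ) < a * Real.exp (-(K * (α n / (n : ℕ)))) := by
  filter_upwards [tendsto_pnat_atTop.eventually_ge_atTop K,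
    tendsto_pnat_atTop.eventually_gt_atTop (-Real.log a)] with n hK ha'
  have hn0 : (0 : ℝ) < (n : ℕ) := by exact_mod_cast n.pos
  rw [coe_tinyRate]
  nth_rewrite 1 [← Real.exp_log ha]
  rw [← Real.exp_add]
  refine Real.exp_lt_exp.2 ?_
  have h1 : K * (α n / (n : ℕ)) ≤ α n := by
    rw [mul_div_assoc', div_le_iff₀ hn0, mul_comm]
    exact mul_le_mul_of_nonneg_left hK (hα n).le
  linarith

end Dispatch

theorem theorem2p2 (lam : ℝ) (hlam₀ : 0 < lam) (hlam₁ : lam < 1) :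
    (∃ Γ : ∀ n : ℕ+, ℝ → Set (Fin n → ℝ≥0),
      (∀ (n : ℕ+) (r : ℝ), 0 < r → Γ n r ⊂ Dispatch.rateSet n) ∧
      ∀ (α : ℕ+ → ℝ) (F : Measure ℝ≥0) (G : ℕ+ → Measure ℝ≥0) (c : ℕ+ → ℕ)
        (P : ∀ n : ℕ+, Dispatch.Policy n (c n))
        (ν : ∀ n : ℕ+, (Fin n → ℝ≥0) → Measure (Dispatch.State n (c n))),
        Dispatch.Admissible lam α F G c P ν →
        ∀ᶠ n : ℕ+ in atTop, Dispatch.stabilityRegion (P n) (G n) F ⊆ Γ n (α n)) ∧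
    (∀ F : Measure ℝ≥0, IsProbabilityMeasure F → ∫⁻ w, (w : ℝ≥0∞) ∂F = 1 →
      ∃ a > (0 : ℝ), ∃ K > (0 : ℝ),
        ∀ (α : ℕ+ → ℝ) (G : ℕ+ → Measure ℝ≥0) (c : ℕ+ → ℕ)
          (P : ∀ n : ℕ+, Dispatch.Policy n (c n))
          (ν : ∀ n : ℕ+, (Fin n → ℝ≥0) → Measure (Dispatch.State n (c n))),
          Dispatch.Admissible lam α F G c P ν →
          ∀ᶠ n : ℕ+ in atTop, ∀ μ ∈ Dispatch.rateSet n, ∀ (ε : ℝ≥0) (N : Finset (Fin n)),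
            N.card = (n : ℕ) / 2 → (∀ i ∈ N, μ i = ε) →
            (∀ᵐ x ∂(ν n μ), ∀ᵐ ω ∂(Dispatch.lawFrom (G n) F x.2.2),
              ENNReal.ofReal ((a * Real.exp (-(K * (α n / (n : ℕ)))) - ε) * (n : ℕ)) ≤
                Dispatch.workloadGrowth (P n) μ x ω) ∧
            ((ε : ℝ) < a * Real.exp (-(K * (α n / (n : ℕ)))) →
              μ ∉ Dispatch.stabilityRegion (P n) (G n) F)) := by
  -- The removed vector depends on `n` and `r` alone; `a` and `K`, which depend on `F`, only affect
  -- how large `n` must be.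
  refine ⟨⟨fun n r => Dispatch.rateSet n \ {Dispatch.slowHalfRates n (Dispatch.tinyRate n r)},
    fun n r hr => ?_, fun α F G c P ν hadm => ?_⟩,
    fun F hF hF1 => Dispatch.exists_growth_constants hlam₀ F hF1⟩
  · have hmem : Dispatch.slowHalfRates n (Dispatch.tinyRate n r) ∈ Dispatch.rateSet n := by
      refine Dispatch.slowHalfRates_mem_rateSet n.pos ?_ ?_
      · rw [← NNReal.coe_pos, Dispatch.coe_tinyRate]
        exact Real.exp_pos _
      · rw [← NNReal.coe_lt_one, Dispatch.coe_tinyRate, Real.exp_lt_one_iff]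
        have : (0 : ℝ) ≤ (n : ℕ) := Nat.cast_nonneg _
        linarith
    exact (Set.ssubset_iff_of_subset Set.sdiff_subset).2 ⟨_, hmem, fun h => h.2 rfl⟩
  · have := hadm.job_prob
    obtain ⟨a, ha, K, hK, h⟩ := Dispatch.exists_growth_constants hlam₀ F hadm.job_mean
    filter_upwards [h α G c P ν hadm,
      Dispatch.eventually_tinyRate_lt (K := K) ha α hadm.message_pos] with n hn htiny μ hμ
    refine ⟨hμ.1, ?_⟩
    rintro rfl
    refine (hn _ hμ.1 (Dispatch.tinyRate n (α n))
      (Finset.univ.filter fun i : Fin n => (i : ℕ) < (n : ℕ) / 2)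
      (Dispatch.card_filter_val_lt_half n) fun i hi => ?_).2 htiny hμ
    exact if_pos (Finset.mem_filter.1 hi).2
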